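/- Let $0<\alpha<1$ and $2\le p_1,p_2,q_1,q_2\le r<\infty$ with $\alpha p_1\le 2$ and $\alpha p_2<2$. Let $D=\sqrt{-\Delta}$ and $\|f\|_{\dot H^{-\alpha}}=\|D^{-\alpha}f\|_{L^2}$. Let $f\neq 0$ be a $\mathbb C^d$-valued distribution (scalar fields, velocity fields and real-valued fields included), and let $(h_n)$ be independent real random variables on a probability space $(\Omega,\mathcal A,\mathcal P)$, all with the same mean-zero Gaussian law. In each of the following two settings a randomization $f^\omega$ of $f$ is defined. (a) Whole space. $f\in\dot H^{-\alpha}(\mathbb R^3)$, that is, $f$ is a tempered distribution with locally integrable Fourier transform and $\|f\|_{\dot H^{-\alpha}}<\infty$. Let $\phi\in C_c^\infty(\mathbb R^3)$ be nonnegative and even, with $\phi=1$ on $(-\frac12,\frac12)^3$ and $\phi=0$ outside $[-1,1]^3$; put $\varphi(\xi)=\phi(\xi)/\sum_{n\in\mathbb Z^3}\phi(\xi-n)$, and let $\varphi(D-n)$ be the Fourier multiplier with symbol $\varphi(\xi-n)$, where $\widehat f(\xi)=\int f(x)e^{-2\pi i x\cdot\xi}\,dx$. Then $f^\omega\in\dot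 H^{-\alpha}(\mathbb R^3)$ is defined by $$D^{-\alpha}f^\omega=\sum_{n\in\mathbb Z^3}h_n(\omega)\,\varphi(D-n)D^{-\alpha}f .$$ (b) Torus. $f\in H^{-\alpha}(\mathbb T^3)$ has mean zero, $\mathbb T^3=\mathbb R^3/\mathbb Z^3$. Let $(e_n)$ be a countable orthonormal basis of $L^2(\mathbb T^3)$ consisting of eigenfunctions of the Laplacian with $\sup_n\|e_n\|_{L^\infty}<\infty$ (for example the exponentials $e^{2\pi i k\cdot x}$, $k\in\mathbb Z^3$, or the corresponding normalized sines and cosines). Write $D^{-\alpha}f=\sum_n a_ne_n$. Then the mean-zero distribution $f^\omega\in H^{-\alpha}(\mathbb T^3)$ is defined by $$D^{-\alpha}f^\omega=\sum_n h_n(\omega)\,a_ne_n .$$ For $\lambda,T>0$ let $E_{p,q}(\lambda,T)$ be the set of all $\omega\in\Omega$ for which $f^\omega$ is defined (the series converges, in the sense of distributions, to an element of $L^2$) and $$\|e^{t\Delta}f^\omega\|_{L^p([0,T];L^q_x)}<\lambda\,\|f\|_{\dot H^{-\alpha}} .$$ Then, in both settings, there is a measurable set $\Sigma\subset\Omega$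 with $\mathcal P(\Sigma)=1$ such that for every $\lambda>0$ and every $\omega\in\Sigma$ there are $\delta>0$ and $M>0$ with $$\omega\in E_{p_1,q_1}(M,\delta)\cap E_{p_2,q_2}(\lambda,\delta).$$ -/

import Mathlib

open MeasureTheory ProbabilityTheory
open scoped NNReal ENNReal SchwartzMap FourierTransform

namespace RandomHeat

noncomputable section

/-- Physical space and frequency space `ℝ³`, with the Euclidean norm. -/
abbrev R3 : Type := EuclideanSpace ℝ (Fin 3)

/-- The values of the data: `ℂ^d` with the Euclidean norm (`d = 1`: scalar functions,
`d = 3`: velocity fields; real-valued data are a special case). -/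
abbrev Val (d : ℕ) : Type := EuclideanSpace ℂ (Fin d)

/-- The lattice point `k ∈ ℤ³` as a vector of `ℝ³`. -/
def latticePoint (k : Fin 3 → ℤ) : R3 := WithLp.toLp 2 fun i => (k i : ℝ)

/-- The norm of `L^p([0,T]; L^q(X, μ))` of a time-dependent object. The proposition `rep t w` says
that the object is, at time `t`, the function `w : X → E`. The value is the mixed Lebesgue norm of
a jointly measurable function `u(t,x)` that represents the object for almost every `t ∈ [0,T]`,
and `∞` if there is no such function. -/
def timeSpaceNorm {X E : Type*} [MeasurableSpace X] [NormedAddCommGroup E] (μ : Measure X)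
    (p q T : ℝ) (rep : ℝ → (X → E) → Prop) : ℝ≥0∞ :=
  ⨅ (u : ℝ × X → E)
    (_ : AEStronglyMeasurable u ((volume.restrict (Set.Icc 0 T)).prod μ))
    (_ : ∀ᵐ t ∂volume.restrict (Set.Icc (0 : ℝ) T), rep t fun x => u (t, x)),
    eLpNorm (fun t => eLpNorm (fun x => u (t, x)) (ENNReal.ofReal q) μ) (ENNReal.ofReal p)
      (volume.restrict (Set.Icc 0 T))

/-! ### The whole space -/

section WholeSpace

variable {d : ℕ}

/-- The tempered distribution `v` is (integration against) the locally integrable function `u`. -/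
def Represents (u : R3 → Val d) (v : 𝓢'(R3, Val d)) : Prop :=
  LocallyIntegrable u ∧
    ∀ ψ : 𝓢(R3, ℂ), Integrable (fun x => ψ x • u x) ∧ v ψ = ∫ x, ψ x • u x

/-- The symbol `(2π|ξ|)^s` of `D^s`, where `D = √(-Δ)` and `𝓕 f(ξ) = ∫ f(x) e^{-2πi x·ξ} dx`. -/
def symbolD (s : ℝ) (ξ : R3) : ℝ := (2 * Real.pi * ‖ξ‖) ^ s

/-- The relation `D^s u = v` between tempered distributions whose Fourier transforms are locally
integrable functions. -/
def IsFracDeriv (s : ℝ) (u v : 𝓢'(R3, Val d)) : Prop :=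
  ∃ F : R3 → Val d, Represents F (𝓕 u) ∧ Represents (fun ξ => symbolD s ξ • F ξ) (𝓕 v)

/-- The norm of the homogeneous Sobolev space `Ḣ^s(ℝ³)`, that is `‖(2π|ξ|)^s 𝓕 f‖_{L²}` if `𝓕 f`
is a locally integrable function, and `∞` otherwise. -/
def hdotNorm (s : ℝ) (f : 𝓢'(R3, Val d)) : ℝ≥0∞ :=
  ⨅ (F : R3 → Val d) (_ : Represents F (𝓕 f)), eLpNorm (fun ξ => symbolD s ξ • F ξ) 2 volume

/-- The heat propagator `e^{tΔ}`, with symbol `e^{-4π²|ξ|²t}` (used for `t ≥ 0`). -/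
def heat (t : ℝ) : 𝓢'(R3, Val d) →L[ℂ] 𝓢'(R3, Val d) :=
  TemperedDistribution.fourierMultiplierCLM (Val d)
    fun ξ => ((Real.exp (-(4 * Real.pi ^ 2 * ‖ξ‖ ^ 2 * t)) : ℝ) : ℂ)

/-- The functions `ϕ` from which the smooth partition of frequency space is made. -/
structure IsCutoff (ϕ : R3 → ℝ) : Prop where
  smooth : ContDiff ℝ ((⊤ : ℕ∞) : WithTop ℕ∞) ϕ
  nonneg : ∀ ξ, 0 ≤ ϕ ξ
  even : ∀ ξ, ϕ (-ξ) = ϕ ξ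
  eq_one : ∀ ξ : R3, (∀ i, ξ i ∈ Set.Ioo (-(1 / 2) : ℝ) (1 / 2)) → ϕ ξ = 1
  eq_zero : ∀ ξ : R3, (¬ ∀ i, ξ i ∈ Set.Icc (-1 : ℝ) 1) → ϕ ξ = 0

/-- `φ(ξ) = ϕ(ξ) / ∑_{n ∈ ℤ³} ϕ(ξ - n)`. -/
def unitBump (ϕ : R3 → ℝ) (ξ : R3) : ℝ :=
  ϕ ξ / ∑' n : Fin 3 → ℤ, ϕ (ξ - latticePoint n)

/-- The Fourier multiplier `φ(D - n)`, with symbol `φ(ξ - n)`. -/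
def freqLoc (ϕ : R3 → ℝ) (n : Fin 3 → ℤ) : 𝓢'(R3, Val d) →L[ℂ] 𝓢'(R3, Val d) :=
  TemperedDistribution.fourierMultiplierCLM (Val d)
    fun ξ => ((unitBump ϕ (ξ - latticePoint n) : ℝ) : ℂ)

/-- `f'` is the randomization of `f` for the outcome `c n = h_n(ω)` of the random coefficients:
`f' ∈ Ḣ^{-α}` and `D^{-α} f' = ∑_n c_n φ(D - n) D^{-α} f`. -/
def IsRandomization (α : ℝ) (ϕ : R3 → ℝ) (c : (Fin 3 → ℤ) → ℝ) (f f' : 𝓢'(R3, Val d)) : Prop :=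
  hdotNorm (-α) f' < ∞ ∧
    ∃ g g' : 𝓢'(R3, Val d), IsFracDeriv (-α) f g ∧ IsFracDeriv (-α) f' g' ∧
      HasSum (fun n => (c n : ℂ) • freqLoc ϕ n g) g'

/-- The event `E_{p,q}(lam, T)` that `‖e^{tΔ} f^ω‖_{L^p([0,T]; L^q)} < lam ‖f‖_{Ḣ^{-α}}`
(in particular, that `f^ω` exists; it is then unique). -/
def goodSet {Ω : Type*} (α : ℝ) (ϕ : R3 → ℝ) (h : (Fin 3 → ℤ) → Ω → ℝ) (f : 𝓢'(R3, Val d))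
    (p q lam T : ℝ) : Set Ω :=
  {ω | ∃ f' : 𝓢'(R3, Val d), IsRandomization α ϕ (fun n => h n ω) f f' ∧
    timeSpaceNorm volume p q T (fun t u => Represents u (heat t f')) <
      ENNReal.ofReal lam * hdotNorm (-α) f}

end WholeSpace

/-! ### The torus -/

section Torus

variable {d : ℕ}

/-- The torus `ℝ³/ℤ³`. -/
abbrev T3 : Type := UnitAddTorus (Fin 3)

/-- The normalized Haar measure of the torus. -/
abbrev torusMeasure : Measure T3 := Measure.pi fun _ => AddCircle.haarAddCircle

/-- Mean zero distributions on the torus are given by their Fourier coefficients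
`k ↦ f k = ∫ f(x) e^{-2πi k·x} dx`; mean zero is `f 0 = 0`. Those of negative Sobolev regularity
are the families with finite `torusHdotNorm`. -/
abbrev TorusDist (d : ℕ) : Type := (Fin 3 → ℤ) → Val d

/-- The eigenvalue `4π²|k|²` of `-Δ` on `e^{2πi k·x}`. -/
def torusEigenvalue (k : Fin 3 → ℤ) : ℝ := 4 * Real.pi ^ 2 * ‖latticePoint k‖ ^ 2

/-- `D^s` on mean zero distributions: multiplication of the Fourier coefficients by `(2π|k|)^s`. -/
def torusD (s : ℝ) (f : TorusDist d) : TorusDist d := fun k =>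
  if k = 0 then 0 else (2 * Real.pi * ‖latticePoint k‖) ^ s • f k

/-- The norm `‖D^s f‖_{L²}` of a mean zero distribution, written through Parseval's identity. -/
def torusHdotNorm (s : ℝ) (f : TorusDist d) : ℝ≥0∞ := eLpNorm (torusD s f) 2 Measure.count

/-- The heat propagator `e^{tΔ}` on the torus. -/
def torusHeat (t : ℝ) (f : TorusDist d) : TorusDist d := fun k =>
  Real.exp (-(torusEigenvalue k * t)) • f k

/-- The distribution `v` is the integrable function `u`. -/
def TorusRepresents (u : T3 → Val d) (v : TorusDist d) : Prop :=
  Integrable u torusMeasure ∧ ∀ k, UnitAddTorus.mFourierCoeff u k = v k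

/-- An orthonormal basis `(e_n)` of `L²(𝕋³)` consists of eigenfunctions of the Laplacian
(`-Δ e_n = μ_n e_n`, expressed by Fourier coefficients) that are uniformly bounded. -/
structure IsBoundedEigenbasis {ι : Type*} (e : HilbertBasis ι ℂ (Lp ℂ 2 torusMeasure)) :
    Prop where
  eigen : ∀ n, ∃ μ : ℝ, ∀ k, (torusEigenvalue k : ℂ) * UnitAddTorus.mFourierCoeff (e n) k =
    (μ : ℂ) * UnitAddTorus.mFourierCoeff (e n) k
  bounded : ∃ C : ℝ, ∀ n, ∀ᵐ x ∂torusMeasure, ‖e n x‖ ≤ C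

/-- The mean zero distribution `f'` is the randomization of `f` for the outcome `c n = h_n(ω)` of
the random coefficients: `f' ∈ Ḣ^{-α}`, and `D^{-α} f' = ∑_n c_n a_n e_n` where
`D^{-α} f = ∑_n a_n e_n` with square-summable `a_n ∈ ℂ^d`. The sums are taken in each Fourier
coefficient, which for these series gives the same limit as the sum in `L²`. -/
def IsTorusRandomization {ι : Type*} (α : ℝ) (e : HilbertBasis ι ℂ (Lp ℂ 2 torusMeasure))
    (c : ι → ℝ) (f f' : TorusDist d) : Prop :=
  f' 0 = 0 ∧ torusHdotNorm (-α) f' < ∞ ∧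
    ∃ a : ι → Val d, (Summable fun n => ‖a n‖ ^ 2) ∧
      (∀ k, HasSum (fun n => UnitAddTorus.mFourierCoeff (e n) k • a n) (torusD (-α) f k)) ∧
      (∀ k, HasSum (fun n => (c n : ℂ) • UnitAddTorus.mFourierCoeff (e n) k • a n)
        (torusD (-α) f' k))

/-- The event `E_{p,q}(lam, T)` on the torus. -/
def torusGoodSet {Ω ι : Type*} (α : ℝ) (e : HilbertBasis ι ℂ (Lp ℂ 2 torusMeasure))
    (h : ι → Ω → ℝ) (f : TorusDist d) (p q lam T : ℝ) : Set Ω :=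
  {ω | ∃ f' : TorusDist d, IsTorusRandomization α e (fun n => h n ω) f f' ∧
    timeSpaceNorm torusMeasure p q T (fun t u => TorusRepresents u (torusHeat t f')) <
      ENNReal.ofReal lam * torusHdotNorm (-α) f}

end Torus

end

end RandomHeat

namespace RandomHeat

noncomputable section

/-! ### Integral inequalities -/

/-! The heat flow of the random datum is a Gaussian series `w = ∑ h_n u_n(t,x)`, and Gaussian
moments turn it into its square function: `E|w|^q ≤ C (∑ |u_n|²)^(q/2)`. The point of randomizing in
pieces is that this square function is bounded by one number `B(t)`, a multiple of `‖e^{tΔ}f‖²_{L²}`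
or its analogue on the torus, both uniformly in `x` and in `L¹_x`. On `ℝ³` the uniform bound is
Bernstein's inequality on unit frequency cells; on `𝕋³` it is the uniform boundedness of the
eigenfunctions. Hence `E ∫ |w|^q dx ≤ C B(t)^(q/2)` at no cost in derivatives. For `p ≤ q`, Jensen
in `ω` and Fatou along finite partial sums bound the expected `p`-th power of the `L^p_t L^q_x` norm
by a multiple of `∫ B(t)^(p/2) dt` (`ae_lintegral_gaussian_series_lt_top`).

This time integral is finite when `α p ≤ 2`. With `ν` the finite measure of density `|D^{-α}f|²` in
frequency, `B(t)` is a multiple of `∫ (s^α e^{-s²t})² dν`; Jensen with exponent `p/2 ≥ 1` and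
Tonelli reduce the claim to `∫₀¹ (s^α e^{-s²t})^p dt ≤ 2` uniformly in `s`
(`lintegral_heatEnergy_rpow_lt_top`).

For a general pair, the series bound is used with `Q = max p q`. The exponent `q` is then recovered
by interpolation with `L²` on `ℝ³`, where almost surely the random datum is itself in `Ḣ^{-α}` and
the same energy estimate applies to it, and by inclusion of Lebesgue spaces on `𝕋³`.

Almost surely both norms on `[0,1]` are therefore finite, and by absolute continuity of the integral
both norms on `[0,δ]` tend to `0` with `δ` (`exists_timeSpaceNorm_lt`). The rest identifies these
pointwise series with the distributions `e^{tΔ}f^ω`. -/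

lemma rpow_lintegral_le {Y : Type*} [MeasurableSpace Y] (ν : Measure Y) [IsFiniteMeasure ν]
    {f : Y → ℝ≥0∞} (hf : AEMeasurable f ν) {r : ℝ} (hr : 1 ≤ r) :
    (∫⁻ y, f y ∂ν) ^ r ≤ ν Set.univ ^ (r - 1) * ∫⁻ y, f y ^ r ∂ν := by
  rcases hr.eq_or_lt with rfl | hr
  · simp
  have hc : r.HolderConjugate (Real.conjExponent r) := .conjExponent hr
  have h := ENNReal.lintegral_mul_le_Lp_mul_Lq ν hc hf (aemeasurable_const (b := (1 : ℝ≥0∞)))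
  simp only [Pi.mul_apply, mul_one, ENNReal.one_rpow, lintegral_const, one_mul] at h
  have h2 := ENNReal.rpow_le_rpow h (zero_le_one.trans hr.le)
  refine h2.trans (le_of_eq ?_)
  rw [ENNReal.mul_rpow_of_nonneg _ _ (zero_le_one.trans hr.le), ← ENNReal.rpow_mul,
    ← ENNReal.rpow_mul, mul_comm]
  congr 2
  · rw [← hc.div_conj_eq_sub_one]; ring
  · rw [one_div_mul_cancel (by linarith), ENNReal.rpow_one]

/-- The preceding inequality with exponent `r⁻¹`, applied to `f ^ r`. It moves an expectation inside
the concave power `p / q`. -/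
lemma lintegral_rpow_le {Y : Type*} [MeasurableSpace Y] (ν : Measure Y) [IsProbabilityMeasure ν]
    {f : Y → ℝ≥0∞} (hf : AEMeasurable f ν) {r : ℝ} (hr₀ : 0 < r) (hr : r ≤ 1) :
    ∫⁻ y, f y ^ r ∂ν ≤ (∫⁻ y, f y ∂ν) ^ r := by
  have h := rpow_lintegral_le ν (hf.pow_const r) (one_le_inv_iff₀.2 ⟨hr₀, hr⟩)
  simp only [← ENNReal.rpow_mul, mul_inv_cancel₀ hr₀.ne', ENNReal.rpow_one, measure_univ,
    ENNReal.one_rpow, one_mul] at h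
  calc _ = ((∫⁻ y, f y ^ r ∂ν) ^ r⁻¹) ^ r := by
        rw [← ENNReal.rpow_mul, inv_mul_cancel₀ hr₀.ne', ENNReal.rpow_one]
    _ ≤ _ := ENNReal.rpow_le_rpow h hr₀.le

/-- Interpolation of `L^q` between `L^2` and `L^Q`. -/
lemma lintegral_rpow_le_interpolate {X : Type*} [MeasurableSpace X] (μ : Measure X)
    {f : X → ℝ≥0∞} (hf : AEMeasurable f μ) {q Q : ℝ} (hq : 2 ≤ q) (hQ : q ≤ Q) :
    (∫⁻ x, f x ^ q ∂μ) ^ (1 / q) ≤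
      2 * ((∫⁻ x, f x ^ (2 : ℝ) ∂μ) ^ (1 / 2 : ℝ) + (∫⁻ x, f x ^ Q ∂μ) ^ (1 / Q)) := by
  set a := (∫⁻ x, f x ^ (2 : ℝ) ∂μ) ^ (1 / 2 : ℝ) with ha
  set b := (∫⁻ x, f x ^ Q ∂μ) ^ (1 / Q) with hb
  have hq0 : 0 < q := by linarith
  have hQ0 : 0 < Q := by linarith
  rcases eq_or_ne (a + b) ∞ with h | h
  · simp [h]
  rcases eq_or_ne (a + b) 0 with h0 | h0
  · have ha0 : a = 0 := (add_eq_zero.1 h0).1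
    rw [ha, ENNReal.rpow_eq_zero_iff_of_pos (by norm_num),
      lintegral_eq_zero_iff' (hf.pow_const _)] at ha0
    have : ∫⁻ x, f x ^ q ∂μ = 0 := by
      rw [lintegral_eq_zero_iff' (hf.pow_const _)]
      filter_upwards [ha0] with x hx
      have : f x = 0 := by simpa using hx
      simp [this, hq0]
    rw [this, ENNReal.zero_rpow_of_pos (by positivity)]
    exact zero_le
  -- After division by `N` both endpoint integrals are at most `1`, and `y^q ≤ y² + y^Q` for every
  -- `y ≥ 0`. The integral is thus at most `2`, and `2^(1/q) ≤ 2`.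
  set N := a + b with hN
  have key : ∀ r : ℝ, 0 < r → (∫⁻ x, f x ^ r ∂μ) ^ (1 / r) ≤ N →
      ∫⁻ x, (f x / N) ^ r ∂μ ≤ 1 := by
    intro r hr hle
    simp_rw [ENNReal.div_rpow_of_nonneg _ _ hr.le, div_eq_mul_inv]
    rw [lintegral_mul_const' _ _ (by simp [h0, ENNReal.rpow_eq_zero_iff, h]),
      ← div_eq_mul_inv]
    refine ENNReal.div_le_of_le_mul ?_
    rw [one_mul]
    calc _ = ((∫⁻ x, f x ^ r ∂μ) ^ (1 / r)) ^ r := by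
          rw [← ENNReal.rpow_mul, one_div_mul_cancel hr.ne', ENNReal.rpow_one]
      _ ≤ _ := ENNReal.rpow_le_rpow hle hr.le
  have h2 := key 2 (by norm_num) (le_add_right le_rfl)
  have hQ' := key Q hQ0 (le_add_left le_rfl)
  have hq' : ∫⁻ x, (f x / N) ^ q ∂μ ≤ 2 := by
    calc _ ≤ ∫⁻ x, ((f x / N) ^ (2 : ℝ) + (f x / N) ^ Q) ∂μ := by
          refine lintegral_mono fun x => ?_
          rcases le_total (f x / N) 1 with h1 | h1
          · exact le_add_right (ENNReal.rpow_le_rpow_of_exponent_ge h1 hq)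
          · exact le_add_left (ENNReal.rpow_le_rpow_of_exponent_le h1 hQ)
      _ = _ := lintegral_add_left' ((hf.div_const _).pow_const _) _
      _ ≤ 1 + 1 := add_le_add h2 hQ'
      _ = 2 := one_add_one_eq_two
  simp_rw [ENNReal.div_rpow_of_nonneg _ _ hq0.le, div_eq_mul_inv] at hq'
  rw [lintegral_mul_const' _ _ (by simp [h0, ENNReal.rpow_eq_zero_iff, h]),
      ← div_eq_mul_inv, ENNReal.div_le_iff (by simp [ENNReal.rpow_eq_zero_iff, h0, h])
      (by simp [ENNReal.rpow_eq_top_iff, h0, h])] at hq'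
  calc _ ≤ (2 * N ^ q) ^ (1 / q) := ENNReal.rpow_le_rpow hq' (by positivity)
    _ = 2 ^ (1 / q) * N := by
      rw [ENNReal.mul_rpow_of_nonneg _ _ (by positivity), ← ENNReal.rpow_mul,
        mul_one_div_cancel hq0.ne', ENNReal.rpow_one]
    _ ≤ 2 ^ (1 : ℝ) * N := by
      gcongr
      · norm_num
      · rw [div_le_one hq0]; linarith
    _ = _ := by rw [ENNReal.rpow_one]

/-! ### The heat kernel in time -/

/-- The symbol `s^α e^{-s² t}` of `D^α e^{tΔ}` at frequency `s = |ξ|`. -/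
def heatWeight (α s t : ℝ) : ℝ := s ^ α * Real.exp (-(s ^ 2 * t))

lemma heatWeight_nonneg {α s t : ℝ} (hs : 0 ≤ s) : 0 ≤ heatWeight α s t := by
  unfold heatWeight; positivity

/-- For `s ≤ 1` the weight is at most `1`; for `s ≥ 1`, `s^(αp) ≤ s²`. The term `s² e^{-s²t}` is an
exact time derivative, so the endpoint `α p = 2` costs nothing. -/
lemma heatWeight_rpow_le {α s t p : ℝ} (hα : 0 ≤ α) (hp : 1 ≤ p) (hαp : α * p ≤ 2) (hs : 0 ≤ s)
    (ht : 0 ≤ t) : heatWeight α s t ^ p ≤ 1 + s ^ 2 * Real.exp (-(s ^ 2 * t)) := by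
  unfold heatWeight
  have hst : 0 ≤ s ^ 2 * t := by positivity
  rcases le_total s 1 with h | h
  · have h1 : s ^ α ≤ 1 := Real.rpow_le_one hs h hα
    have h2 : Real.exp (-(s ^ 2 * t)) ≤ 1 := Real.exp_le_one_iff.2 (by linarith)
    have h3 : s ^ α * Real.exp (-(s ^ 2 * t)) ≤ 1 := mul_le_one₀ h1 (Real.exp_pos _).le h2
    have := Real.rpow_le_one (by positivity) h3 (zero_le_one.trans hp)
    have : 0 ≤ s ^ 2 * Real.exp (-(s ^ 2 * t)) := by positivity
    linarith
  · rw [Real.mul_rpow (by positivity) (by positivity), ← Real.rpow_mul hs, ← Real.exp_mul]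
    have h1 : s ^ (α * p) ≤ s ^ 2 := by
      rw [← Real.rpow_natCast]
      exact Real.rpow_le_rpow_of_exponent_le h (by exact_mod_cast hαp)
    have h2 : Real.exp (-(s ^ 2 * t) * p) ≤ Real.exp (-(s ^ 2 * t)) :=
      Real.exp_le_exp.2 (by nlinarith)
    have : s ^ (α * p) * Real.exp (-(s ^ 2 * t) * p) ≤ s ^ 2 * Real.exp (-(s ^ 2 * t)) :=
      mul_le_mul h1 h2 (by positivity) (by positivity)
    linarith

lemma lintegral_heatWeight_rpow_le {α s p : ℝ} (hα : 0 ≤ α) (hp : 1 ≤ p) (hαp : α * p ≤ 2)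
    (hs : 0 ≤ s) :
    ∫⁻ t in Set.Icc (0 : ℝ) 1, ENNReal.ofReal (heatWeight α s t) ^ p ≤ 2 := by
  -- The primitive grows by `2 - e^{-s²}` over `[0,1]`, which is bounded independently of `s`.
  have hder : ∀ t ∈ Set.uIcc (0 : ℝ) 1, HasDerivAt (fun t => t - Real.exp (-(s ^ 2 * t)))
      (1 + s ^ 2 * Real.exp (-(s ^ 2 * t))) t := by
    intro t _
    have h1 : HasDerivAt (fun t : ℝ => -(s ^ 2 * t)) (-(s ^ 2)) t := by
      simpa using ((hasDerivAt_id' t).const_mul (s ^ 2)).fun_neg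
    have := (hasDerivAt_id t).sub h1.exp
    convert! this using 1
    ring
  have hcont : Continuous fun t : ℝ => 1 + s ^ 2 * Real.exp (-(s ^ 2 * t)) := by fun_prop
  calc _ ≤ ∫⁻ t in Set.Icc (0 : ℝ) 1, ENNReal.ofReal (1 + s ^ 2 * Real.exp (-(s ^ 2 * t))) := by
        refine setLIntegral_mono' measurableSet_Icc fun t ht => ?_
        rw [ENNReal.ofReal_rpow_of_nonneg (heatWeight_nonneg hs) (by linarith)]
        exact ENNReal.ofReal_le_ofReal (heatWeight_rpow_le hα hp hαp hs ht.1)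
    _ = ENNReal.ofReal (∫ t in (0 : ℝ)..1, (1 + s ^ 2 * Real.exp (-(s ^ 2 * t)))) := by
        rw [intervalIntegral.integral_of_le zero_le_one, ← integral_Icc_eq_integral_Ioc,
          ofReal_integral_eq_lintegral_ofReal]
        · exact hcont.continuousOn.integrableOn_Icc
        · exact ae_of_all _ fun t => by positivity
    _ ≤ 2 := by
        rw [intervalIntegral.integral_eq_sub_of_hasDerivAt hder (hcont.intervalIntegrable _ _)]
        refine ENNReal.ofReal_le_of_le_toReal ?_
        have := Real.exp_pos (-(s ^ 2 * 1))
        simp only [mul_one, mul_zero, neg_zero, Real.exp_zero, ENNReal.toReal_ofNat] at this ⊢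
        linarith

/-- The `L^{p/2}` norm in time of the energy `∫ |s^α e^{-s² t}|² dν` of the heat flow. -/
lemma lintegral_heatEnergy_rpow_lt_top {Y : Type*} [MeasurableSpace Y] (ν : Measure Y)
    [IsFiniteMeasure ν] {s : Y → ℝ} (hs : Measurable s) (hs₀ : ∀ y, 0 ≤ s y) {α p : ℝ}
    (hα : 0 ≤ α) (hp : 2 ≤ p) (hαp : α * p ≤ 2) :
    ∫⁻ t in Set.Icc (0 : ℝ) 1,
      (∫⁻ y, ENNReal.ofReal (heatWeight α (s y) t) ^ (2 : ℝ) ∂ν) ^ (p / 2) < ∞ := by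
  have hm : Measurable fun z : ℝ × Y => ENNReal.ofReal (heatWeight α (s z.2) z.1) := by
    unfold heatWeight; fun_prop
  have hp1 : 1 ≤ p / 2 := by linarith
  -- Jensen with exponent `p / 2 ≥ 1` against `ν`, then Tonelli, so that the time integral is taken
  -- at a fixed frequency.
  calc _ ≤ ∫⁻ t in Set.Icc (0 : ℝ) 1, ν Set.univ ^ (p / 2 - 1) *
        ∫⁻ y, ENNReal.ofReal (heatWeight α (s y) t) ^ p ∂ν := by
        refine lintegral_mono fun t => ?_
        refine (rpow_lintegral_le ν ?_ hp1).trans (le_of_eq ?_)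
        · exact ((hm.comp measurable_prodMk_left).pow_const _).aemeasurable
        · simp_rw [← ENNReal.rpow_mul]
          congr 3 with y
          congr 1
          ring
    _ = ν Set.univ ^ (p / 2 - 1) * ∫⁻ y, (∫⁻ t in Set.Icc (0 : ℝ) 1,
          ENNReal.ofReal (heatWeight α (s y) t) ^ p) ∂ν := by
        rw [lintegral_const_mul' _ _ (by finiteness), lintegral_lintegral_swap]
        exact (hm.pow_const p).aemeasurable
    _ ≤ ν Set.univ ^ (p / 2 - 1) * ∫⁻ _, 2 ∂ν := by
        gcongr with y
        exact lintegral_heatWeight_rpow_le hα (by linarith) hαp (hs₀ y)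
    _ < ∞ := by
        rw [lintegral_const]
        finiteness

/-! ### Moments of Gaussian series -/

lemma exists_rpow_le_mul_exp (q : ℝ) (hq : 0 ≤ q) :
    ∃ K : ℝ, 0 ≤ K ∧ ∀ x : ℝ, |x| ^ q ≤ K * (Real.exp x + Real.exp (-x)) := by
  -- The constant comes from `y^n / n! ≤ e^y` with `n = ⌈q⌉₊` and `y = 1 + |x|`.
  refine ⟨(⌈q⌉₊).factorial * Real.exp 1, by positivity, fun x => ?_⟩
  have h1 : |x| ^ q ≤ (1 + |x|) ^ ⌈q⌉₊ := by
    rw [← Real.rpow_natCast]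
    exact (Real.rpow_le_rpow (abs_nonneg x) (by linarith) hq).trans
      (Real.rpow_le_rpow_of_exponent_le (by linarith [abs_nonneg x]) (Nat.le_ceil q))
  have h2 := Real.pow_div_factorial_le_exp (1 + |x|) (by positivity) ⌈q⌉₊
  rw [div_le_iff₀ (by positivity)] at h2
  have h3 : Real.exp |x| ≤ Real.exp x + Real.exp (-x) := by
    rcases abs_cases x with ⟨h, _⟩ | ⟨h, _⟩ <;> rw [h] <;>
      linarith [Real.exp_pos x, Real.exp_pos (-x)]
  calc _ ≤ Real.exp (1 + |x|) * (⌈q⌉₊).factorial := h1.trans h2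
    _ = (⌈q⌉₊).factorial * Real.exp 1 * Real.exp |x| := by rw [Real.exp_add]; ring
    _ ≤ _ := by gcongr

variable {Ω : Type*} [MeasurableSpace Ω] {P : Measure Ω}

lemma hasSubgaussianMGF_of_hasLaw {X : Ω → ℝ} {v : ℝ≥0} (h : HasLaw X (gaussianReal 0 v) P) :
    HasSubgaussianMGF X v P where
  integrable_exp_mul t := by
    have := integrable_exp_mul_gaussianReal (μ := 0) (v := v) t
    rw [← h.map_eq] at this
    exact this.comp_aemeasurable h.aemeasurable
  mgf_le t := by rw [mgf_gaussianReal h.map_eq]; simp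


lemma hasSubgaussianMGF_const_mul {X : Ω → ℝ} {c : ℝ≥0} (hX : HasSubgaussianMGF X c P) (r : ℝ) :
    HasSubgaussianMGF (fun ω => r * X ω) (‖r‖₊ ^ 2 * c) P := by
  have h := hX.const_mul r
  have e : (⟨r ^ 2, sq_nonneg r⟩ : ℝ≥0) = ‖r‖₊ ^ 2 := by
    refine NNReal.eq (show r ^ 2 = ((‖r‖₊ ^ 2 : ℝ≥0) : ℝ) from ?_)
    simp
  rwa [e] at h

/-- Dividing by `√c` reduces to variance proxy `1`, where the power is dominated by the exponential
moments at `±1`. For `c = 0` the variable vanishes almost surely. -/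
lemma exists_lintegral_rpow_le_of_hasSubgaussianMGF (P : Measure Ω) [IsProbabilityMeasure P]
    (q : ℝ) (hq : 0 < q) :
    ∃ C : ℝ≥0, ∀ (X : Ω → ℝ) (c : ℝ≥0), HasSubgaussianMGF X c P →
      ∫⁻ ω, ‖X ω‖ₑ ^ q ∂P ≤ C * (c : ℝ≥0∞) ^ (q / 2) := by
  obtain ⟨K, hK, hKx⟩ := exists_rpow_le_mul_exp q hq.le
  have unit : ∀ X : Ω → ℝ, HasSubgaussianMGF X 1 P →
      ∫⁻ ω, ‖X ω‖ₑ ^ q ∂P ≤ ENNReal.ofReal (K * (2 * Real.exp (1 / 2))) := by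
    intro X hX
    have i1 := hX.integrable_exp_mul 1
    have i2 := hX.integrable_exp_mul (-1)
    have m1 := hX.mgf_le 1
    have m2 := hX.mgf_le (-1)
    simp only [mgf, one_mul, neg_one_mul, NNReal.coe_one, one_pow, even_two, Even.neg_pow] at i1 i2 m1 m2
    calc _ ≤ ∫⁻ ω, ENNReal.ofReal (K * (Real.exp (X ω) + Real.exp (-X ω))) ∂P := by
          refine lintegral_mono fun ω => ?_
          rw [Real.enorm_eq_ofReal_abs, ENNReal.ofReal_rpow_of_nonneg (abs_nonneg _) hq.le]
          exact ENNReal.ofReal_le_ofReal (hKx _)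
      _ = ENNReal.ofReal (∫ ω, K * (Real.exp (X ω) + Real.exp (-X ω)) ∂P) := by
          rw [ofReal_integral_eq_lintegral_ofReal ((i1.fun_add i2).const_mul K)]
          exact ae_of_all _ fun ω => by positivity
      _ ≤ _ := by
          refine ENNReal.ofReal_le_ofReal ?_
          rw [integral_const_mul, integral_add i1 i2]
          gcongr
          linarith
  refine ⟨(K * (2 * Real.exp (1 / 2))).toNNReal, fun X c hX => ?_⟩
  rcases eq_or_ne c 0 with rfl | hc
  · have h0 := hX.ae_eq_zero_of_hasSubgaussianMGF_zero
    have : ∫⁻ ω, ‖X ω‖ₑ ^ q ∂P = 0 := by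
      rw [lintegral_congr_ae (g := fun _ => 0)]
      · simp
      · filter_upwards [h0] with ω hω
        simp [hω, hq]
    rw [this]; exact zero_le
  have hc0 : 0 < (c : ℝ) := by positivity
  have h1 : HasSubgaussianMGF (fun ω => (√(c : ℝ))⁻¹ * X ω) 1 P := by
    convert hasSubgaussianMGF_const_mul hX (√(c : ℝ))⁻¹ using 1
    ext
    rw [NNReal.coe_one, NNReal.coe_mul, NNReal.coe_pow, coe_nnnorm, Real.norm_eq_abs, sq_abs,
      inv_pow, Real.sq_sqrt hc0.le, inv_mul_cancel₀ hc0.ne']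
  have h2 := unit _ h1
  have hs : ‖√(c : ℝ)‖ₑ ^ q = (c : ℝ≥0∞) ^ (q / 2) := by
    rw [Real.enorm_of_nonneg (Real.sqrt_nonneg _), Real.sqrt_eq_rpow,
      ← ENNReal.ofReal_rpow_of_nonneg hc0.le (by norm_num), ENNReal.ofReal_coe_nnreal,
      ← ENNReal.rpow_mul]
    congr 1; ring
  calc ∫⁻ ω, ‖X ω‖ₑ ^ q ∂P = ∫⁻ ω, ‖√(c : ℝ)‖ₑ ^ q * ‖(√(c : ℝ))⁻¹ * X ω‖ₑ ^ q ∂P := by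
        refine lintegral_congr fun ω => ?_
        rw [← ENNReal.mul_rpow_of_nonneg _ _ hq.le, ← enorm_mul, mul_inv_cancel_left₀]
        positivity
    _ = ‖√(c : ℝ)‖ₑ ^ q * ∫⁻ ω, ‖(√(c : ℝ))⁻¹ * X ω‖ₑ ^ q ∂P :=
        lintegral_const_mul' _ _ (by finiteness)
    _ ≤ _ := by rw [hs, mul_comm]; gcongr; exact h2

variable {ι : Type*} {h : ι → Ω → ℝ} {v : ℝ≥0}

lemma hasSubgaussianMGF_sum (hlaw : ∀ n, HasLaw (h n) (gaussianReal 0 v) P) (hind : iIndepFun h P)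
    (s : Finset ι) (c : ι → ℝ) :
    HasSubgaussianMGF (fun ω => ∑ i ∈ s, c i * h i ω) (∑ i ∈ s, ‖c i‖₊ ^ 2 * v) P := by
  have hind' : iIndepFun (fun i ω => c i * h i ω) P :=
    hind.comp (fun i x => c i * x) fun i => measurable_const_mul _
  refine HasSubgaussianMGF.sum_of_iIndepFun hind' fun i _ => ?_
  exact hasSubgaussianMGF_const_mul (hasSubgaussianMGF_of_hasLaw (hlaw i)) (c i)

variable [IsProbabilityMeasure P]

/-- The moments of a Gaussian sum with coefficients in `ℂ^d` are controlled by its variance. -/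
theorem exists_lintegral_gaussian_sum_rpow_le (hlaw : ∀ n, HasLaw (h n) (gaussianReal 0 v) P)
    (hind : iIndepFun h P) (d : ℕ) (q : ℝ) (hq : 1 ≤ q) :
    ∃ C : ℝ≥0, ∀ (s : Finset ι) (c : ι → Val d),
      ∫⁻ ω, ‖∑ i ∈ s, (h i ω : ℂ) • c i‖ₑ ^ q ∂P ≤ C * (∑ i ∈ s, ‖c i‖ₑ ^ 2) ^ (q / 2) := by
  have hq0 : 0 < q := by linarith
  obtain ⟨C, hC⟩ := exists_lintegral_rpow_le_of_hasSubgaussianMGF P q hq0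
  have hmeas : ∀ (s : Finset ι) (c : ι → ℝ), AEMeasurable (fun ω => ∑ i ∈ s, c i * h i ω) P :=
    fun s c => (hasSubgaussianMGF_sum hlaw hind s c).aemeasurable
  have real : ∀ (s : Finset ι) (c : ι → ℝ) (c' : ι → Val d), (∀ i, ‖c i‖ ≤ ‖c' i‖) →
      ∫⁻ ω, ‖∑ i ∈ s, c i * h i ω‖ₑ ^ q ∂P ≤
        C * (v : ℝ≥0∞) ^ (q / 2) * (∑ i ∈ s, ‖c' i‖ₑ ^ 2) ^ (q / 2) := by
    intro s c c' hcc
    refine (hC _ _ (hasSubgaussianMGF_sum hlaw hind s c)).trans ?_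
    rw [mul_assoc, ← ENNReal.mul_rpow_of_nonneg _ _ (by positivity), ← Finset.sum_mul,
      mul_comm (v : ℝ≥0∞)]
    push_cast
    gcongr with i
    exact enorm_le_iff_norm_le.2 (hcc i)
  -- The factors `d^(q-1)` and `2^(q-1)` come from convexity over the coordinates and over real and
  -- imaginary parts; `d` and `2` count the resulting terms.
  refine ⟨(d : ℝ≥0) ^ (q - 1) * (d * (2 ^ (q - 1) * (2 * (C * v ^ (q / 2))))), fun s c => ?_⟩
  set S := (∑ i ∈ s, ‖c i‖ₑ ^ 2) ^ (q / 2) with hS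
  have hre : ∀ j ω, ((∑ i ∈ s, (h i ω : ℂ) • c i) j).re = ∑ i ∈ s, (c i j).re * h i ω := by
    intro j ω
    simp [mul_comm]
  have him : ∀ j ω, ((∑ i ∈ s, (h i ω : ℂ) • c i) j).im = ∑ i ∈ s, (c i j).im * h i ω := by
    intro j ω
    simp [mul_comm]
  have hnorm : ∀ z : Val d, ‖z‖ₑ ^ q ≤
      (d : ℝ≥0∞) ^ (q - 1) * ∑ j, 2 ^ (q - 1) * (‖(z j).re‖ₑ ^ q + ‖(z j).im‖ₑ ^ q) := by
    intro z
    have h1 : ‖z‖ₑ ≤ ∑ j, (‖(z j).re‖ₑ + ‖(z j).im‖ₑ) := by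
      conv_lhs => rw [← (EuclideanSpace.basisFun (Fin d) ℂ).sum_repr z]
      refine (enorm_sum_le _ _).trans (Finset.sum_le_sum fun j _ => ?_)
      rw [enorm_smul]
      simp only [EuclideanSpace.basisFun_repr, EuclideanSpace.basisFun_apply]
      rw [← ofReal_norm (EuclideanSpace.single j (1 : ℂ))]
      simp only [PiLp.norm_single, norm_one, ENNReal.ofReal_one, mul_one]
      rw [← ofReal_norm, ← ofReal_norm, ← ofReal_norm,
        ← ENNReal.ofReal_add (norm_nonneg _) (norm_nonneg _)]
      exact ENNReal.ofReal_le_ofReal (Complex.norm_le_abs_re_add_abs_im _)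
    refine (ENNReal.rpow_le_rpow h1 hq0.le).trans ?_
    refine (ENNReal.rpow_sum_le_const_mul_sum_rpow _ _ hq).trans ?_
    rw [Finset.card_univ, Fintype.card_fin]
    gcongr with j
    exact ENNReal.rpow_add_le_mul_rpow_add_rpow _ _ hq
  calc _ ≤ ∫⁻ ω, (d : ℝ≥0∞) ^ (q - 1) * ∑ j, 2 ^ (q - 1) *
        (‖∑ i ∈ s, (c i j).re * h i ω‖ₑ ^ q + ‖∑ i ∈ s, (c i j).im * h i ω‖ₑ ^ q) ∂P := by
        refine lintegral_mono fun ω => (hnorm _).trans (le_of_eq ?_)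
        simp_rw [hre, him]
    _ = (d : ℝ≥0∞) ^ (q - 1) * ∑ j, 2 ^ (q - 1) *
        (∫⁻ ω, ‖∑ i ∈ s, (c i j).re * h i ω‖ₑ ^ q ∂P +
          ∫⁻ ω, ‖∑ i ∈ s, (c i j).im * h i ω‖ₑ ^ q ∂P) := by
        have hm1 : ∀ j, AEMeasurable (fun ω => ‖∑ i ∈ s, (c i j).re * h i ω‖ₑ ^ q) P :=
          fun j => (hmeas _ _).enorm.pow_const _
        have hm2 : ∀ j, AEMeasurable (fun ω => ‖∑ i ∈ s, (c i j).im * h i ω‖ₑ ^ q) P :=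
          fun j => (hmeas _ _).enorm.pow_const _
        have hd : (d : ℝ≥0∞) ^ (q - 1) ≠ ∞ :=
          ENNReal.rpow_ne_top_of_nonneg (by linarith) (by simp)
        have h2 : (2 : ℝ≥0∞) ^ (q - 1) ≠ ∞ :=
          ENNReal.rpow_ne_top_of_nonneg (by linarith) (by simp)
        rw [lintegral_const_mul' _ _ hd, lintegral_finsetSum' _
          fun j _ => ((hm1 j).fun_add (hm2 j)).const_mul _]
        congr 1
        refine Finset.sum_congr rfl fun j _ => ?_
        rw [lintegral_const_mul' _ _ h2, lintegral_add_left' (hm1 j)]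
    _ ≤ (d : ℝ≥0∞) ^ (q - 1) * ∑ _j : Fin d, 2 ^ (q - 1) *
        (C * (v : ℝ≥0∞) ^ (q / 2) * S + C * (v : ℝ≥0∞) ^ (q / 2) * S) := by
        gcongr with j
        · exact real s _ c fun i => (Complex.abs_re_le_norm _).trans (PiLp.norm_apply_le _ _)
        · exact real s _ c fun i => (Complex.abs_im_le_norm _).trans (PiLp.norm_apply_le _ _)
    _ = _ := by
        rw [Finset.sum_const, Finset.card_univ, Fintype.card_fin, nsmul_eq_mul]
        push_cast
        rw [ENNReal.coe_rpow_of_nonneg _ (by linarith), ENNReal.coe_rpow_of_nonneg _ (by linarith),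
          ENNReal.coe_rpow_of_nonneg _ (by linarith)]
        push_cast
        ring

/-! ### Space-time norms of Gaussian series -/

lemma ae_pos_restrict_Icc (T : ℝ) : ∀ᵐ t ∂volume.restrict (Set.Icc (0 : ℝ) T), 0 < t := by
  rw [← restrict_Ioc_eq_restrict_Icc]
  filter_upwards [ae_restrict_mem measurableSet_Ioc] with t ht using ht.1

lemma liminf_rpow {β : Type*} {l : Filter β} [l.NeBot] (f : β → ℝ≥0∞) {r : ℝ} (hr : 0 < r) :
    (Filter.liminf f l) ^ r = Filter.liminf (fun b => f b ^ r) l :=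
  (ENNReal.orderIsoRpow r hr).liminf_apply

/-- Interpolation between `L^∞` and `L¹`: pointwise `g^(q/2) ≤ B^(q/2-1) g`. -/
lemma rpow_sum_lintegral_le {X : Type*} [MeasurableSpace X] (μ : Measure X) {g : X → ℝ≥0∞}
    {B : ℝ≥0∞} {q : ℝ} (hq : 2 ≤ q) (hsup : ∀ᵐ x ∂μ, g x ≤ B) (hint : ∫⁻ x, g x ∂μ ≤ B)
    (hB : B ≠ ∞) : ∫⁻ x, g x ^ (q / 2) ∂μ ≤ B ^ (q / 2) := by
  have hq' : 0 ≤ q / 2 - 1 := by linarith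
  calc _ ≤ ∫⁻ x, B ^ (q / 2 - 1) * g x ∂μ := by
        refine lintegral_mono_ae ?_
        filter_upwards [hsup] with x hx
        calc g x ^ (q / 2) = g x ^ (q / 2 - 1) * g x ^ (1 : ℝ) := by
              rw [← ENNReal.rpow_add_of_nonneg _ _ hq' zero_le_one]; congr 1; ring
          _ ≤ _ := by rw [ENNReal.rpow_one]; gcongr
    _ = B ^ (q / 2 - 1) * ∫⁻ x, g x ∂μ :=
        lintegral_const_mul' _ _ (ENNReal.rpow_ne_top_of_nonneg hq' hB)
    _ ≤ B ^ (q / 2 - 1) * B ^ (1 : ℝ) := by rw [ENNReal.rpow_one]; gcongr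
    _ = _ := by rw [← ENNReal.rpow_add_of_nonneg _ _ hq' zero_le_one]; congr 1; ring

section Series

variable {Ω : Type*} [MeasurableSpace Ω] {P : Measure Ω} [IsProbabilityMeasure P]
  {ι : Type*} [Countable ι] {h : ι → Ω → ℝ} {v : ℝ≥0}

/-- A Gaussian series whose square function is bounded by `√(B t)`, both uniformly and in `L²`, lies
almost surely in `L^p([0,1]; L^q)`. -/
theorem ae_lintegral_gaussian_series_lt_top (hlaw : ∀ n, HasLaw (h n) (gaussianReal 0 v) P)
    (hind : iIndepFun h P) {X : Type*} [MeasurableSpace X] (μ : Measure X) [SFinite μ] {d : ℕ}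
    {p q : ℝ} (hp : 2 ≤ p) (hpq : p ≤ q) {u : ι → ℝ × X → Val d}
    (hu : ∀ n, StronglyMeasurable (u n)) {B : ℝ → ℝ≥0∞}
    (hsup : ∀ t, 0 < t → ∀ᵐ x ∂μ, ∑' n, ‖u n (t, x)‖ₑ ^ 2 ≤ B t)
    (hint : ∀ t, 0 < t → ∫⁻ x, ∑' n, ‖u n (t, x)‖ₑ ^ 2 ∂μ ≤ B t)
    (hB : ∫⁻ t in Set.Icc (0 : ℝ) 1, B t ^ (p / 2) < ∞) (hBt : ∀ t, 0 < t → B t ≠ ∞) :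
    ∀ᵐ ω ∂P, ∀ w : ℝ → X → Val d,
      (∀ t, 0 < t → ∀ᵐ x ∂μ, HasSum (fun n => (h n ω : ℂ) • u n (t, x)) (w t x)) →
      ∫⁻ t in Set.Icc (0 : ℝ) 1, (∫⁻ x, ‖w t x‖ₑ ^ q ∂μ) ^ (p / q) < ∞ := by
  have hq : 2 ≤ q := hp.trans hpq
  have hq0 : 0 < q := by linarith
  have hr0 : 0 < p / q := by positivity
  have hr1 : p / q ≤ 1 := (div_le_one hq0).2 hpq
  obtain ⟨C, hC⟩ := exists_lintegral_gaussian_sum_rpow_le hlaw hind d q (by linarith)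
  -- The coefficients are only almost everywhere measurable; genuinely measurable versions give the
  -- joint measurability in `(ω, t, x)` that Tonelli requires.
  set g : ι → Ω → ℝ := fun n => (hlaw n).aemeasurable.mk (h n) with hg
  have hgm : ∀ n, Measurable (g n) := fun n => (hlaw n).aemeasurable.measurable_mk
  have hgh : ∀ᵐ ω ∂P, ∀ n, h n ω = g n ω := ae_all_iff.2 fun n => (hlaw n).aemeasurable.ae_eq_mk
  set T := volume.restrict (Set.Icc (0 : ℝ) 1) with hT
  have hTpos : ∀ᵐ t ∂T, 0 < t := ae_pos_restrict_Icc 1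
  -- Fatou's lemma is applied along a sequence, so a cofinal sequence of finite index sets replaces
  -- the net of all of them.
  obtain ⟨s, hs⟩ := Filter.exists_seq_tendsto (Filter.atTop : Filter (Finset ι))
  set U : ℕ → Ω × ℝ × X → ℝ≥0∞ := fun k z => ‖∑ i ∈ s k, (g i z.1 : ℂ) • u i z.2‖ₑ ^ q with hU
  have hUm : ∀ k, Measurable (U k) := by
    intro k
    refine Measurable.pow_const (StronglyMeasurable.enorm ?_) q
    refine Finset.stronglyMeasurable_fun_sum _ fun i _ => ?_
    exact (Complex.measurable_ofReal.comp ((hgm i).comp measurable_fst)).stronglyMeasurable.smul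
      ((hu i).comp_measurable measurable_snd)
  set Z : ℕ → Ω → ℝ≥0∞ := fun k ω => ∫⁻ t, (∫⁻ x, U k (ω, t, x) ∂μ) ^ (p / q) ∂T with hZ
  have hI : ∀ k, Measurable fun z : Ω × ℝ => ∫⁻ x, U k (z.1, z.2, x) ∂μ := by
    intro k
    have : Measurable fun z : (Ω × ℝ) × X => U k (z.1.1, z.1.2, z.2) :=
      (hUm k).comp (by fun_prop)
    exact this.lintegral_prod_right'
  have hZm : ∀ k, Measurable (Z k) := fun k => ((hI k).pow_const _).lintegral_prod_right'
  have hZle : ∀ k, ∫⁻ ω, Z k ω ∂P ≤ ∫⁻ t, (C : ℝ≥0∞) ^ (p / q) * B t ^ (p / 2) ∂T := by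
    intro k
    simp only [hZ]
    rw [lintegral_lintegral_swap ((hI k).pow_const _).aemeasurable]
    refine lintegral_mono_ae ?_
    filter_upwards [hTpos] with t ht
    have hm1 : Measurable fun z : Ω × X => U k (z.1, t, z.2) := (hUm k).comp (by fun_prop)
    -- Jensen in `ω` for the concave power `p / q`: this is where `p ≤ q` is needed.
    calc _ ≤ (∫⁻ ω, ∫⁻ x, U k (ω, t, x) ∂μ ∂P) ^ (p / q) :=
          lintegral_rpow_le P ((hI k).comp measurable_prodMk_right).aemeasurable hr0 hr1
      _ = (∫⁻ x, ∫⁻ ω, U k (ω, t, x) ∂P ∂μ) ^ (p / q) := by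
          rw [lintegral_lintegral_swap hm1.aemeasurable]
      _ ≤ (∫⁻ x, C * (∑ i ∈ s k, ‖u i (t, x)‖ₑ ^ 2) ^ (q / 2) ∂μ) ^ (p / q) := by
          gcongr with x
          refine le_trans (le_of_eq ?_) (hC (s k) fun i => u i (t, x))
          refine lintegral_congr_ae ?_
          filter_upwards [hgh] with ω hω
          simp [hU, hω]
      _ ≤ (C * B t ^ (q / 2)) ^ (p / q) := by
          rw [lintegral_const_mul' _ _ ENNReal.coe_ne_top]
          gcongr
          refine rpow_sum_lintegral_le μ hq ?_ ?_ (hBt t ht)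
          · filter_upwards [hsup t ht] with x hx using (ENNReal.sum_le_tsum _).trans hx
          · exact (lintegral_mono fun x => ENNReal.sum_le_tsum _).trans (hint t ht)
      _ = _ := by
          rw [ENNReal.mul_rpow_of_nonneg _ _ hr0.le, ← ENNReal.rpow_mul]
          congr 2
          field_simp
  have hCr : (C : ℝ≥0∞) ^ (p / q) ≠ ∞ := ENNReal.rpow_ne_top_of_nonneg hr0.le (by simp)
  have hlim : ∀ᵐ ω ∂P, Filter.liminf (fun k => Z k ω) Filter.atTop < ∞ := by
    refine ae_lt_top (Measurable.liminf hZm) (ne_of_lt ?_)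
    calc _ ≤ Filter.liminf (fun k => ∫⁻ ω, Z k ω ∂P) Filter.atTop := lintegral_liminf_le hZm
      _ ≤ Filter.liminf (fun _ : ℕ => ∫⁻ t, (C : ℝ≥0∞) ^ (p / q) * B t ^ (p / 2) ∂T)
          Filter.atTop := Filter.liminf_le_liminf (Filter.Eventually.of_forall hZle)
      _ = (C : ℝ≥0∞) ^ (p / q) * ∫⁻ t, B t ^ (p / 2) ∂T := by
          rw [Filter.liminf_const, lintegral_const_mul' _ _ hCr]
      _ < ∞ := ENNReal.mul_lt_top hCr.lt_top hB
  -- The null set is fixed before `w` is chosen. Fatou is used once more for this `ω`, in `x` and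
  -- then in `t`.
  filter_upwards [hlim, hgh] with ω hω hωg w hw
  refine lt_of_le_of_lt ?_ hω
  calc _ ≤ ∫⁻ t, Filter.liminf (fun k => (∫⁻ x, U k (ω, t, x) ∂μ) ^ (p / q)) Filter.atTop ∂T := by
        refine lintegral_mono_ae ?_
        filter_upwards [hTpos] with t ht
        rw [← liminf_rpow _ hr0]
        gcongr
        refine le_trans (lintegral_mono_ae ?_) (lintegral_liminf_le fun k => ?_)
        · filter_upwards [hw t ht] with x hx
          have h1 : Filter.Tendsto (fun k => U k (ω, t, x)) Filter.atTop (nhds (‖w t x‖ₑ ^ q)) := by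
            refine (ENNReal.continuous_rpow_const.tendsto _).comp
              ((continuous_enorm.tendsto _).comp ?_)
            have := hx.comp hs
            refine this.congr fun k => ?_
            simp [hωg]
          exact h1.liminf_eq.ge
        · exact (hUm k).comp (by fun_prop)
    _ ≤ _ := lintegral_liminf_le fun k => ((hI k).comp measurable_prodMk_left).pow_const _

/-- Square-summability of the coefficients is almost surely preserved by the randomization. -/
lemma ae_tsum_gaussian_sq_lt_top (hlaw : ∀ n, HasLaw (h n) (gaussianReal 0 v) P)
    {A : ι → ℝ≥0∞} (hA : ∑' n, A n ≠ ∞) : ∀ᵐ ω ∂P, ∑' n, ‖h n ω‖ₑ ^ 2 * A n < ∞ := by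
  obtain ⟨C, hC⟩ := exists_lintegral_rpow_le_of_hasSubgaussianMGF P 2 two_pos
  have hm : ∀ n, AEMeasurable (fun ω => ‖h n ω‖ₑ ^ 2 * A n) P := fun n =>
    ((hlaw n).aemeasurable.enorm.pow_const 2).mul_const _
  refine ae_lt_top' (AEMeasurable.tsum hm) (ne_of_lt ?_)
  rw [lintegral_tsum hm]
  calc _ ≤ ∑' n, (C * (v : ℝ≥0∞)) * A n := by
        refine ENNReal.tsum_le_tsum fun n => ?_
        have hAn : A n ≠ ∞ := ne_top_of_le_ne_top hA (ENNReal.le_tsum n)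
        rw [lintegral_mul_const' _ _ hAn]
        gcongr
        simpa using hC _ _ (hasSubgaussianMGF_of_hasLaw (hlaw n))
    _ = (C * (v : ℝ≥0∞)) * ∑' n, A n := ENNReal.tsum_mul_left
    _ < ∞ := ENNReal.mul_lt_top (by finiteness) hA.lt_top

end Series

/-! ### Passing to short times -/

section ShortTime

variable {X : Type*} [MeasurableSpace X] {μ : Measure X} {d : ℕ}

lemma eLpNorm_eLpNorm_eq {p q T : ℝ} (hp : 0 < p) (hq : 0 < q) (w : ℝ → X → Val d) :
    eLpNorm (fun t => eLpNorm (w t) (ENNReal.ofReal q) μ) (ENNReal.ofReal p)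
      (volume.restrict (Set.Icc 0 T)) =
    (∫⁻ t in Set.Icc 0 T, (∫⁻ x, ‖w t x‖ₑ ^ q ∂μ) ^ (p / q)) ^ (1 / p) := by
  rw [eLpNorm_eq_lintegral_rpow_enorm_toReal (by simpa using hp) (by simp),
    ENNReal.toReal_ofReal hp.le]
  congr 2 with t
  rw [eLpNorm_eq_lintegral_rpow_enorm_toReal (by simpa using hq) (by simp),
    ENNReal.toReal_ofReal hq.le, enorm_eq_self, ← ENNReal.rpow_mul]
  congr 1
  ring

/-- Absolute continuity of the integral: the integrand has finite integral over `[0,1]` and the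
measure of `[0,δ]` tends to `0`. -/
lemma tendsto_eLpNorm_short_time {p q : ℝ} (hp : 0 < p) (hq : 0 < q) {w : ℝ → X → Val d}
    (hw : ∫⁻ t in Set.Icc (0 : ℝ) 1, (∫⁻ x, ‖w t x‖ₑ ^ q ∂μ) ^ (p / q) < ∞) :
    Filter.Tendsto (fun δ => eLpNorm (fun t => eLpNorm (w t) (ENNReal.ofReal q) μ)
      (ENNReal.ofReal p) (volume.restrict (Set.Icc 0 δ))) (nhdsWithin 0 (Set.Ioi (0 : ℝ)))
      (nhds 0) := by
  simp_rw [eLpNorm_eLpNorm_eq hp hq]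
  rw [show nhds (0 : ℝ≥0∞) = nhds (0 ^ (1 / p)) by
    rw [ENNReal.zero_rpow_of_pos (by positivity)]]
  refine (ENNReal.continuous_rpow_const.tendsto _).comp ?_
  have hl : Filter.Tendsto ((volume.restrict (Set.Icc (0 : ℝ) 1)) ∘ fun δ => Set.Icc (0 : ℝ) δ)
      (nhdsWithin 0 (Set.Ioi (0 : ℝ))) (nhds 0) := by
    have h1 : Filter.Tendsto (fun δ : ℝ => ENNReal.ofReal δ) (nhdsWithin 0 (Set.Ioi (0 : ℝ)))
        (nhds 0) := by
      have := (ENNReal.continuous_ofReal.tendsto 0).mono_left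
        (nhdsWithin_le_nhds (s := Set.Ioi (0 : ℝ)))
      simpa using this
    refine tendsto_of_tendsto_of_tendsto_of_le_of_le tendsto_const_nhds h1 (fun _ => zero_le)
      fun δ => ?_
    refine (Measure.restrict_apply_le _ _).trans ?_
    simp
  refine (tendsto_setLIntegral_zero hw.ne hl).congr' ?_
  have : ∀ᶠ δ in nhdsWithin (0 : ℝ) (Set.Ioi 0), δ < 1 :=
    Filter.Eventually.filter_mono nhdsWithin_le_nhds (gt_mem_nhds one_pos)
  filter_upwards [this] with δ hδ
  rw [Measure.restrict_restrict measurableSet_Icc,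
    Set.inter_eq_left.2 (Set.Icc_subset_Icc_right hδ.le)]

/-- If a function of finite `L^{p_i}([0,1]; L^{q_i})` norms represents an object for positive times,
then its norms over short time intervals are as required by the good sets. -/
lemma exists_timeSpaceNorm_lt [SFinite μ] {rep : ℝ → (X → Val d) → Prop} {w : ℝ → X → Val d}
    {p₁ p₂ q₁ q₂ : ℝ} (hp₁ : 0 < p₁) (hp₂ : 0 < p₂) (hq₁ : 0 < q₁) (hq₂ : 0 < q₂)
    (hwm : AEStronglyMeasurable (fun z : ℝ × X => w z.1 z.2)
      ((volume.restrict (Set.Icc (0 : ℝ) 1)).prod μ))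
    (hrep : ∀ t, 0 < t → rep t (w t))
    (h₁ : ∫⁻ t in Set.Icc (0 : ℝ) 1, (∫⁻ x, ‖w t x‖ₑ ^ q₁ ∂μ) ^ (p₁ / q₁) < ∞)
    (h₂ : ∫⁻ t in Set.Icc (0 : ℝ) 1, (∫⁻ x, ‖w t x‖ₑ ^ q₂ ∂μ) ^ (p₂ / q₂) < ∞)
    {N : ℝ≥0∞} (hN : N ≠ 0) {lam : ℝ} (hlam : 0 < lam) :
    ∃ δ : ℝ, 0 < δ ∧ ∃ M : ℝ, 0 < M ∧
      timeSpaceNorm μ p₁ q₁ δ rep < ENNReal.ofReal M * N ∧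
      timeSpaceNorm μ p₂ q₂ δ rep < ENNReal.ofReal lam * N := by
  have t₁ := tendsto_eLpNorm_short_time hp₁ hq₁ h₁
  have t₂ := tendsto_eLpNorm_short_time hp₂ hq₂ h₂
  -- Both norms tend to `0` with `δ`, so any positive threshold is reached; `M = 1` is taken for the
  -- first.
  have e₁ := t₁.eventually_lt_const
    (show 0 < ENNReal.ofReal 1 * N by simpa using pos_iff_ne_zero.2 hN)
  have e₂ := t₂.eventually_lt_const
    (show 0 < ENNReal.ofReal lam * N from ENNReal.mul_pos (by simpa using hlam) hN)
  have : ∀ᶠ δ in nhdsWithin (0 : ℝ) (Set.Ioi 0), δ < 1 :=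
    Filter.Eventually.filter_mono nhdsWithin_le_nhds (gt_mem_nhds one_pos)
  obtain ⟨δ, h1, h2, h3, h4⟩ := (e₁.and (e₂.and (this.and self_mem_nhdsWithin))).exists
  have key : ∀ p q : ℝ, timeSpaceNorm μ p q δ rep ≤
      eLpNorm (fun t => eLpNorm (w t) (ENNReal.ofReal q) μ) (ENNReal.ofReal p)
        (volume.restrict (Set.Icc 0 δ)) := by
    intro p q
    refine iInf₂_le_of_le (fun z : ℝ × X => w z.1 z.2) ?_ (iInf_le_of_le ?_ le_rfl)
    · refine hwm.mono_measure ?_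
      exact Measure.prod_mono (Measure.restrict_mono (Set.Icc_subset_Icc_right h3.le) le_rfl) le_rfl
    · filter_upwards [ae_pos_restrict_Icc δ] with t ht using hrep t ht
  exact ⟨δ, h4, 1, one_pos, (key _ _).trans_lt h1, (key _ _).trans_lt h2⟩

end ShortTime

/-! ### Functions and tempered distributions -/

section Represent

variable {d : ℕ}

lemma Represents.congr_ae {u u' : R3 → Val d} {v : 𝓢'(R3, Val d)} (h : Represents u v)
    (huu : u =ᵐ[volume] u') : Represents u' v := by
  refine ⟨?_, fun ψ => ?_⟩
  · intro x
    obtain ⟨s, hs, hi⟩ := h.1 x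
    exact ⟨s, hs, hi.congr_fun_ae (ae_restrict_of_ae huu)⟩
  · have e : (fun x => ψ x • u x) =ᵐ[volume] fun x => ψ x • u' x := by
      filter_upwards [huu] with x hx
      rw [hx]
    exact ⟨(h.2 ψ).1.congr e, (h.2 ψ).2.trans (integral_congr_ae e)⟩

/-- Smooth compactly supported functions already determine a locally integrable function. Norms
defined through a representative thus do not depend on its choice. -/
lemma Represents.ae_eq {u u' : R3 → Val d} {v : 𝓢'(R3, Val d)} (h : Represents u v)
    (h' : Represents u' v) : u =ᵐ[volume] u' := by
  refine ae_eq_of_integral_contDiff_smul_eq h.1 h'.1 fun g hg hgc => ?_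
  have hg₁ : HasCompactSupport (Complex.ofRealCLM ∘ g) := hgc.comp_left rfl
  have hg₂ : ContDiff ℝ (⊤ : ℕ∞) (Complex.ofRealCLM ∘ g) := by fun_prop
  have e := (h.2 (hg₁.toSchwartzMap hg₂)).2.symm.trans (h'.2 (hg₁.toSchwartzMap hg₂)).2
  simpa using e

lemma Represents.memLp_toLp {G : R3 → Val d} (hG : MemLp G 2 volume) :
    Represents G (Lp.toTemperedDistribution (hG.toLp G) : 𝓢'(R3, Val d)) := by
  refine ⟨hG.locallyIntegrable one_le_two, fun ψ => ⟨?_, ?_⟩⟩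
  · exact memLp_one_iff_integrable.1 (MemLp.smul (p := 2) (q := 2) (r := 1) hG (ψ.memLp 2 volume))
  · rw [Lp.toTemperedDistribution_apply]
    refine integral_congr_ae ?_
    filter_upwards [hG.coeFn_toLp] with x hx
    rw [hx]

lemma Represents.smul {F : R3 → Val d} {v : 𝓢'(R3, Val d)} (h : Represents F v) {m : R3 → ℂ}
    (hm : m.HasTemperateGrowth) :
    Represents (fun x => m x • F x) (TemperedDistribution.smulLeftCLM (Val d) m v) := by
  refine ⟨?_, fun ψ => ?_⟩
  · exact h.1.continuous_smul hm.1.continuous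
  · have e := h.2 (SchwartzMap.smulLeftCLM ℂ m ψ)
    have e2 : (fun x => (SchwartzMap.smulLeftCLM ℂ m ψ) x • F x) = fun x => ψ x • m x • F x := by
      ext1 x
      rw [SchwartzMap.smulLeftCLM_apply_apply hm, smul_eq_mul, mul_comm, mul_smul]
    rw [e2] at e
    exact ⟨e.1, by rw [TemperedDistribution.smulLeftCLM_apply_apply]; exact e.2⟩

lemma symbolD_nonneg (s : ℝ) (ξ : R3) : 0 ≤ symbolD s ξ := by unfold symbolD; positivity

@[fun_prop]
lemma measurable_symbolD (s : ℝ) : Measurable (symbolD s) := by unfold symbolD; fun_prop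

lemma ae_ne_zero : ∀ᵐ ξ : R3, ξ ≠ 0 := by
  rw [ae_iff]; simp

lemma symbolD_mul_symbolD_neg (s : ℝ) {ξ : R3} (hξ : ξ ≠ 0) : symbolD s ξ * symbolD (-s) ξ = 1 := by
  have : 0 < 2 * Real.pi * ‖ξ‖ := by have := norm_pos_iff.2 hξ; positivity
  rw [symbolD, symbolD, ← Real.rpow_add this, add_neg_cancel, Real.rpow_zero]

/-- Functions of the form `|ξ|^s G` with `G ∈ L²` are tempered distributions. -/
lemma exists_represents_symbolD_smul {s : ℝ} (hs₀ : 0 ≤ s) (hs : s ≤ 2) {G F : R3 → Val d}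
    (hG : MemLp G 2 volume) (hF : F =ᵐ[volume] fun ξ => symbolD s ξ • G ξ) :
    ∃ v : 𝓢'(R3, Val d), Represents F v := by
  -- The symbol `|2πξ|^s` need not be smooth at `0`. The polynomial `m` is, has temperate growth,
  -- and dominates the symbol for `0 ≤ s ≤ 2`; what remains after division by `m` is in `L²`.
  set m : R3 → ℝ := fun ξ => 1 + (2 * Real.pi) ^ 2 * ‖ξ‖ ^ 2 with hm
  have hm0 : ∀ ξ, 0 < m ξ := fun ξ => by positivity
  have hmt : (fun ξ => ((m ξ : ℝ) : ℂ)).HasTemperateGrowth := by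
    have h1 : m.HasTemperateGrowth :=
      (Function.HasTemperateGrowth.const _).add
        ((Function.HasTemperateGrowth.const _).mul (Function.hasTemperateGrowth_norm_sq R3))
    exact Function.Complex.hasTemperateGrowth_ofReal.comp h1
  have hmm : Measurable m := by fun_prop
  have hle : ∀ ξ, symbolD s ξ ≤ m ξ := by
    intro ξ
    have hx : 0 ≤ 2 * Real.pi * ‖ξ‖ := by positivity
    have : (2 * Real.pi * ‖ξ‖) ^ s ≤ 1 + (2 * Real.pi * ‖ξ‖) ^ 2 := by
      rcases le_total (2 * Real.pi * ‖ξ‖) 1 with h | h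
      · have := Real.rpow_le_one hx h hs₀
        have : 0 ≤ (2 * Real.pi * ‖ξ‖) ^ 2 := by positivity
        linarith
      · have := Real.rpow_le_rpow_of_exponent_le h hs
        rw [Real.rpow_two] at this
        linarith
    rw [symbolD, hm]
    simpa [mul_pow] using this
  have hK : MemLp (fun ξ => (symbolD s ξ / m ξ) • G ξ) 2 volume := by
    refine hG.of_le (((measurable_symbolD s).div hmm).aestronglyMeasurable.smul
      hG.aestronglyMeasurable) (ae_of_all _ fun ξ => ?_)
    rw [norm_smul, Real.norm_of_nonneg (div_nonneg (symbolD_nonneg _ _) (hm0 ξ).le)]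
    exact mul_le_of_le_one_left (norm_nonneg _) ((div_le_one (hm0 ξ)).2 (hle ξ))
  refine ⟨_, ((Represents.memLp_toLp hK).smul hmt).congr_ae ?_⟩
  filter_upwards [hF] with ξ hξ
  rw [hξ, Complex.coe_smul, smul_smul, mul_div_cancel₀ _ (hm0 ξ).ne']

/-! ### The inverse Fourier transform of integrable functions -/

/-- Fubini's multiplication formula. It identifies the distributional inverse Fourier transform of
an integrable function with the pointwise integral. -/
lemma fourierInv_integral_smul_eq {K : R3 → Val d} (hK : Integrable K) (ψ : 𝓢(R3, ℂ)) :
    ∫ x, ψ x • 𝓕⁻ K x = ∫ ξ, (𝓕⁻ ψ) ξ • K ξ := by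
  have h1 : ∀ x, 𝓕⁻ K x = 𝓕 K (-x) := Real.fourierInv_eq_fourier_neg K
  have hψ : Integrable (fun x => ψ (-x)) := ψ.integrable.comp_neg
  have h2 : ∫ x, ψ x • 𝓕 K (-x) = ∫ x, ψ (-x) • 𝓕 K x := by
    rw [← integral_neg_eq_self]; simp
  simp_rw [h1]
  rw [h2]
  have h3 := VectorFourier.integral_fourierIntegral_smul_eq_flip (L := innerₗ R3)
    (μ := volume) (ν := volume) Real.continuous_fourierChar continuous_inner hψ hK
  have h4 : (innerₗ R3).flip = innerₗ R3 := by
    ext x y; simp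
  rw [h4] at h3
  refine h3.symm.trans (integral_congr_ae (ae_of_all _ fun ξ => ?_))
  have h5 : (𝓕⁻ ψ) ξ = 𝓕 (fun x => ψ (-x)) ξ := by
    rw [SchwartzMap.fourierInv_coe, Real.fourierInv_eq_fourier_comp_neg]
  simp only [h5]
  rfl

lemma continuous_fourierInv {K : R3 → Val d} (hK : Integrable K) : Continuous (𝓕⁻ K) := by
  have h1 : 𝓕⁻ K = fun x => 𝓕 K (-x) := funext (Real.fourierInv_eq_fourier_neg K)
  rw [h1]
  refine Continuous.comp ?_ continuous_neg
  exact VectorFourier.fourierIntegral_continuous (L := innerₗ R3) Real.continuous_fourierChar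
    continuous_inner hK

lemma norm_fourierInv_le (K : R3 → Val d) (x : R3) : ‖𝓕⁻ K x‖ ≤ ∫ ξ, ‖K ξ‖ := by
  rw [Real.fourierInv_eq_fourier_neg]
  exact VectorFourier.norm_fourierIntegral_le_integral_norm _ _ _ _ _

lemma enorm_fourierInv_le (K : R3 → Val d) (x : R3) : ‖𝓕⁻ K x‖ₑ ≤ ∫⁻ ξ, ‖K ξ‖ₑ := by
  rw [Real.fourierInv_eq]
  refine (enorm_integral_le_lintegral_enorm _).trans (le_of_eq ?_)
  congr with ξ
  rw [← ofReal_norm, Circle.norm_smul, ofReal_norm]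

lemma Represents.fourierInv {K : R3 → Val d} {v : 𝓢'(R3, Val d)} (h : Represents K v)
    (hK : Integrable K) : Represents (𝓕⁻ K) (𝓕⁻ v) := by
  have hc := continuous_fourierInv hK
  refine ⟨hc.locallyIntegrable, fun ψ => ⟨?_, ?_⟩⟩
  · exact ψ.integrable.smul_bdd (∫ ξ, ‖K ξ‖) hc.aestronglyMeasurable
      (ae_of_all _ (norm_fourierInv_le K))
  · rw [TemperedDistribution.fourierInv_apply, (h.2 _).2, fourierInv_integral_smul_eq hK]

/-- Plancherel's theorem. -/
lemma lintegral_enorm_fourierInv_sq {K : R3 → Val d} (hK : Integrable K) (hK2 : MemLp K 2 volume) :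
    ∫⁻ x, ‖𝓕⁻ K x‖ₑ ^ 2 = ∫⁻ ξ, ‖K ξ‖ₑ ^ 2 := by
  have h1 := (Represents.memLp_toLp hK2).fourierInv hK
  rw [Lp.fourierInv_toTemperedDistribution_eq] at h1
  have hL := Lp.memLp (𝓕⁻ (hK2.toLp K))
  have h2 := Represents.memLp_toLp hL
  rw [Lp.toLp_coeFn] at h2
  have h3 := h1.ae_eq h2
  have h4 : ‖𝓕⁻ (hK2.toLp K)‖ = ‖hK2.toLp K‖ := by
    rw [← Lp.norm_fourier_eq, FourierTransform.fourier_fourierInv_eq]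
  rw [Lp.norm_def, Lp.norm_def, ENNReal.toReal_eq_toReal_iff' (Lp.eLpNorm_ne_top _)
    (Lp.eLpNorm_ne_top _), eLpNorm_congr_ae h3.symm, eLpNorm_congr_ae hK2.coeFn_toLp] at h4
  rw [eLpNorm_eq_lintegral_rpow_enorm_toReal two_ne_zero ENNReal.ofNat_ne_top,
    eLpNorm_eq_lintegral_rpow_enorm_toReal two_ne_zero ENNReal.ofNat_ne_top] at h4
  simp only [ENNReal.toReal_ofNat, ENNReal.rpow_ofNat] at h4
  exact ENNReal.rpow_left_injective (by norm_num) h4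

end Represent

/-! ### The symbols of the heat propagator and of the frequency localization -/

lemma hasTemperateGrowth_heatSymbol {t : ℝ} (ht : 0 ≤ t) :
    (fun ξ : R3 => ((Real.exp (-(4 * Real.pi ^ 2 * ‖ξ‖ ^ 2 * t)) : ℝ) : ℂ)).HasTemperateGrowth := by
  have h1 : (fun ξ : R3 => -(4 * Real.pi ^ 2 * ‖ξ‖ ^ 2 * t)).HasTemperateGrowth :=
    (((Function.HasTemperateGrowth.const _).mul (Function.hasTemperateGrowth_norm_sq R3)).mul
      (Function.HasTemperateGrowth.const _)).neg
  have h2 : (Real.exp ∘ fun ξ : R3 => -(4 * Real.pi ^ 2 * ‖ξ‖ ^ 2 * t)).HasTemperateGrowth := by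
    -- The exponential does not have temperate growth on `ℝ`, but the exponent takes values in `(-∞,
    -- 0]`. On the open neighborhood `Iio 1` all derivatives of `exp` are bounded by `e`.
    refine Function.HasTemperateGrowth.comp' (t := Set.Iio 1) ?_ (isOpen_Iio.uniqueDiffOn)
      Real.contDiff_exp.contDiffOn (fun N => ⟨0, Real.exp 1, (Real.exp_pos _).le, ?_⟩) h1
    · rintro - ⟨ξ, rfl⟩
      have : 0 ≤ 4 * Real.pi ^ 2 * ‖ξ‖ ^ 2 * t := by positivity
      simp only [Set.mem_Iio]
      linarith
    · intro n _ x hx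
      rw [norm_iteratedFDerivWithin_eq_norm_iteratedDerivWithin,
        iteratedDerivWithin_eq_iteratedDeriv isOpen_Iio.uniqueDiffOn
          (Real.contDiff_exp.contDiffAt) hx, iteratedDeriv_eq_iterate, Real.iter_deriv_exp,
        Real.norm_of_nonneg (Real.exp_pos _).le]
      simpa using (Set.mem_Iio.1 hx).le
  exact Function.Complex.hasTemperateGrowth_ofReal.comp h2

@[simp]
lemma latticePoint_apply (k : Fin 3 → ℤ) (i : Fin 3) : latticePoint k i = k i := rfl

section UnitBump

variable {ϕ : R3 → ℝ}

/-- The lattice translates of `[-1,1]³` that meet the unit ball around `ξ` are among these. -/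
def nearbyLattice (ξ : R3) : Finset (Fin 3 → ℤ) :=
  Finset.Icc (fun i => ⌊ξ i⌋ - 2) (fun i => ⌈ξ i⌉ + 2)

lemma IsCutoff.eq_zero_of_notMem_nearbyLattice (hϕ : IsCutoff ϕ) {ξ₀ ξ : R3} (h : dist ξ ξ₀ < 1)
    {n : Fin 3 → ℤ} (hn : n ∉ nearbyLattice ξ₀) : ϕ (ξ - latticePoint n) = 0 := by
  refine hϕ.eq_zero _ fun hi => hn ?_
  rw [nearbyLattice, Finset.mem_Icc, Pi.le_def, Pi.le_def]
  -- The margin `2` in `nearbyLattice` is `1` for the support cube plus `1` for the ball around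
  -- `ξ₀`.
  have hd : ∀ i, |ξ i - ξ₀ i| < 1 := by
    intro i
    rw [dist_eq_norm] at h
    have := (PiLp.norm_apply_le (ξ - ξ₀) i).trans_lt h
    simpa [Real.norm_eq_abs] using this
  refine ⟨fun i => ?_, fun i => ?_⟩
  · have h1 := (hi i).2
    have h2 := (abs_lt.1 (hd i)).1
    have h3 := Int.floor_le (ξ₀ i)
    simp only [PiLp.sub_apply, latticePoint_apply] at h1
    have : ((⌊ξ₀ i⌋ - 2 : ℤ) : ℝ) ≤ (n i : ℝ) := by push_cast; linarith
    exact_mod_cast this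
  · have h1 := (hi i).1
    have h2 := (abs_lt.1 (hd i)).2
    have h3 := Int.le_ceil (ξ₀ i)
    simp only [PiLp.sub_apply, latticePoint_apply] at h1
    have : (n i : ℝ) ≤ ((⌈ξ₀ i⌉ + 2 : ℤ) : ℝ) := by push_cast; linarith
    exact_mod_cast this

lemma IsCutoff.hasSum (hϕ : IsCutoff ϕ) {ξ₀ ξ : R3} (h : dist ξ ξ₀ < 1) :
    HasSum (fun n => ϕ (ξ - latticePoint n)) (∑ n ∈ nearbyLattice ξ₀, ϕ (ξ - latticePoint n)) :=
  hasSum_sum_of_ne_finset_zero fun _ hn => hϕ.eq_zero_of_notMem_nearbyLattice h hn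

lemma IsCutoff.summable (hϕ : IsCutoff ϕ) (ξ : R3) :
    Summable fun n => ϕ (ξ - latticePoint n) :=
  (hϕ.hasSum (ξ₀ := ξ) (by simp)).summable

/-- Continuity along the segment `r • ξ`, `r < 1`, extends the value from the open cube to the
closed one, whose lattice translates cover space. -/
lemma IsCutoff.eq_one_of_abs_le (hϕ : IsCutoff ϕ) {ξ : R3} (h : ∀ i, |ξ i| ≤ 1 / 2) : ϕ ξ = 1 := by
  have hcl : IsClosed {r : ℝ | ϕ (r • ξ) = 1} :=
    isClosed_eq (hϕ.smooth.continuous.comp (by fun_prop)) continuous_const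
  have hsub : Set.Ico (0 : ℝ) 1 ⊆ {r : ℝ | ϕ (r • ξ) = 1} := by
    intro r hr
    refine hϕ.eq_one _ fun i => ?_
    rw [PiLp.smul_apply, smul_eq_mul, Set.mem_Ioo, ← abs_lt, abs_mul, abs_of_nonneg hr.1]
    nlinarith [h i, abs_nonneg (ξ i), hr.1, hr.2]
  have := hcl.closure_subset_iff.2 hsub
  rw [closure_Ico zero_ne_one] at this
  simpa using this (Set.right_mem_Icc.2 zero_le_one)

/-- Rounding each coordinate of `ξ` gives a lattice point whose term equals `1`. The denominator of
`unitBump` therefore never vanishes. -/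
lemma IsCutoff.one_le_tsum (hϕ : IsCutoff ϕ) (ξ : R3) :
    1 ≤ ∑' n, ϕ (ξ - latticePoint n) := by
  rw [← hϕ.eq_one_of_abs_le (ξ := ξ - latticePoint fun i => round (ξ i))]
  · exact (hϕ.summable ξ).le_tsum _ fun _ _ => hϕ.nonneg _
  · intro i
    simpa using abs_sub_round (ξ i)

lemma IsCutoff.contDiff_tsum (hϕ : IsCutoff ϕ) :
    ContDiff ℝ (⊤ : ℕ∞) fun ξ => ∑' n, ϕ (ξ - latticePoint n) := by
  rw [contDiff_iff_contDiffAt]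
  intro ξ₀
  have h1 : ContDiff ℝ (⊤ : ℕ∞) fun ξ => ∑ n ∈ nearbyLattice ξ₀, ϕ (ξ - latticePoint n) :=
    ContDiff.sum fun n _ => hϕ.smooth.comp (contDiff_id.sub contDiff_const)
  refine h1.contDiffAt.congr_of_eventuallyEq ?_
  filter_upwards [Metric.ball_mem_nhds ξ₀ one_pos] with ξ hξ
  exact (hϕ.hasSum hξ).tsum_eq

/-- The denominator is invariant under lattice translations. -/
lemma unitBump_sub (ϕ : R3 → ℝ) (ξ : R3) (m : Fin 3 → ℤ) :
    unitBump ϕ (ξ - latticePoint m) =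
      ϕ (ξ - latticePoint m) / ∑' n, ϕ (ξ - latticePoint n) := by
  rw [unitBump]
  congr 1
  rw [← (Equiv.addLeft m).tsum_eq fun n => ϕ (ξ - latticePoint n)]
  refine tsum_congr fun n => ?_
  congr 1
  ext i
  simp only [PiLp.sub_apply, latticePoint_apply, Equiv.coe_addLeft, Pi.add_apply]
  push_cast
  ring

lemma IsCutoff.unitBump_nonneg (hϕ : IsCutoff ϕ) (ξ : R3) : 0 ≤ unitBump ϕ ξ :=
  div_nonneg (hϕ.nonneg ξ) (zero_le_one.trans (hϕ.one_le_tsum ξ))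

lemma IsCutoff.hasSum_unitBump (hϕ : IsCutoff ϕ) (ξ : R3) :
    HasSum (fun n => unitBump ϕ (ξ - latticePoint n)) 1 := by
  simp_rw [unitBump_sub ϕ]
  rw [← div_self (zero_lt_one.trans_le (hϕ.one_le_tsum ξ)).ne']
  exact (hϕ.summable ξ).hasSum.div_const _

lemma IsCutoff.unitBump_eq_zero (hϕ : IsCutoff ϕ) {ξ : R3} {n : Fin 3 → ℤ}
    (hn : n ∉ nearbyLattice ξ) : unitBump ϕ (ξ - latticePoint n) = 0 := by
  rw [unitBump, hϕ.eq_zero_of_notMem_nearbyLattice (ξ₀ := ξ) (by simp) hn, zero_div]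

lemma IsCutoff.unitBump_le_one (hϕ : IsCutoff ϕ) (ξ : R3) : unitBump ϕ ξ ≤ 1 := by
  have h := hϕ.hasSum_unitBump ξ
  have h0 := le_hasSum h 0 fun n _ => hϕ.unitBump_nonneg _
  have : latticePoint 0 = 0 := by ext i; simp
  rwa [this, sub_zero] at h0

lemma IsCutoff.contDiff_unitBump (hϕ : IsCutoff ϕ) : ContDiff ℝ (⊤ : ℕ∞) (unitBump ϕ) :=
  hϕ.smooth.div hϕ.contDiff_tsum fun ξ => (zero_lt_one.trans_le (hϕ.one_le_tsum ξ)).ne'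

lemma IsCutoff.hasCompactSupport_unitBump (hϕ : IsCutoff ϕ) : HasCompactSupport (unitBump ϕ) := by
  refine HasCompactSupport.intro (isCompact_closedBall (0 : R3) 2) fun ξ hξ => ?_
  rw [unitBump, hϕ.eq_zero ξ, zero_div]
  refine fun h => hξ ?_
  rw [mem_closedBall_zero_iff]
  refine abs_le_of_sq_le_sq' ?_ zero_le_two |>.2
  rw [EuclideanSpace.norm_sq_eq]
  have : ∀ i, ‖ξ i‖ ^ 2 ≤ 1 := fun i => by
    rw [Real.norm_eq_abs, sq_abs, sq_le_one_iff_abs_le_one, abs_le]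
    exact h i
  rw [Fin.sum_univ_three]
  linarith [this 0, this 1, this 2]

lemma IsCutoff.hasTemperateGrowth_unitBump (hϕ : IsCutoff ϕ) (n : Fin 3 → ℤ) :
    (fun ξ : R3 => ((unitBump ϕ (ξ - latticePoint n) : ℝ) : ℂ)).HasTemperateGrowth := by
  have h1 : (unitBump ϕ).HasTemperateGrowth :=
    hϕ.hasCompactSupport_unitBump.hasTemperateGrowth hϕ.contDiff_unitBump
  have h2 : (fun ξ : R3 => ξ - latticePoint n).HasTemperateGrowth :=
    Function.HasTemperateGrowth.id'.sub (Function.HasTemperateGrowth.const _)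
  exact Function.Complex.hasTemperateGrowth_ofReal.comp (h1.comp h2)

lemma IsCutoff.measurable_unitBump (hϕ : IsCutoff ϕ) : Measurable (unitBump ϕ) :=
  hϕ.contDiff_unitBump.continuous.measurable

lemma IsCutoff.lintegral_unitBump_lt_top (hϕ : IsCutoff ϕ) :
    ∫⁻ ξ, ENNReal.ofReal (unitBump ϕ ξ) < ∞ :=
  (hϕ.contDiff_unitBump.continuous.integrable_of_hasCompactSupport
    hϕ.hasCompactSupport_unitBump).lintegral_lt_top

lemma lintegral_unitBump_sub (ϕ : R3 → ℝ) (n : Fin 3 → ℤ) :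
    ∫⁻ ξ, ENNReal.ofReal (unitBump ϕ (ξ - latticePoint n)) = ∫⁻ ξ, ENNReal.ofReal (unitBump ϕ ξ) :=
  lintegral_sub_right_eq_self (fun ξ => ENNReal.ofReal (unitBump ϕ ξ)) _

lemma IsCutoff.tsum_ofReal_unitBump (hϕ : IsCutoff ϕ) (ξ : R3) :
    ∑' n, ENNReal.ofReal (unitBump ϕ (ξ - latticePoint n)) = 1 := by
  rw [← ENNReal.ofReal_tsum_of_nonneg (fun n => hϕ.unitBump_nonneg _)
    (hϕ.hasSum_unitBump ξ).summable, (hϕ.hasSum_unitBump ξ).tsum_eq, ENNReal.ofReal_one]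

end UnitBump

/-! ### The randomized symbol -/

lemma memLp_two_of_lintegral_lt_top {X : Type*} [MeasurableSpace X] {μ : Measure X} {d : ℕ}
    {f : X → Val d} (hf : AEStronglyMeasurable f μ) (h : ∫⁻ x, ‖f x‖ₑ ^ 2 ∂μ < ∞) :
    MemLp f 2 μ := by
  refine ⟨hf, ?_⟩
  rw [eLpNorm_lt_top_iff_lintegral_rpow_enorm_lt_top two_ne_zero ENNReal.ofNat_ne_top]
  simpa using h

lemma lintegral_lt_top_of_memLp_two {X : Type*} [MeasurableSpace X] {μ : Measure X} {d : ℕ}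
    {f : X → Val d} (h : MemLp f 2 μ) : ∫⁻ x, ‖f x‖ₑ ^ 2 ∂μ < ∞ := by
  have := h.2
  rw [eLpNorm_lt_top_iff_lintegral_rpow_enorm_lt_top two_ne_zero ENNReal.ofNat_ne_top] at this
  simpa using this

/-- The Fourier multiplier `∑_n c_n φ(ξ - n)`. -/
def randSymbol (ϕ : R3 → ℝ) (c : (Fin 3 → ℤ) → ℝ) (ξ : R3) : ℝ :=
  ∑' n, c n * unitBump ϕ (ξ - latticePoint n)

section RandSymbol

variable {ϕ : R3 → ℝ} {d : ℕ}

lemma IsCutoff.hasSum_randSymbol_finset (hϕ : IsCutoff ϕ) (c : (Fin 3 → ℤ) → ℝ) (ξ : R3) :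
    HasSum (fun n => c n * unitBump ϕ (ξ - latticePoint n))
      (∑ n ∈ nearbyLattice ξ, c n * unitBump ϕ (ξ - latticePoint n)) :=
  hasSum_sum_of_ne_finset_zero fun n hn => by rw [hϕ.unitBump_eq_zero hn, mul_zero]

lemma IsCutoff.hasSum_randSymbol (hϕ : IsCutoff ϕ) (c : (Fin 3 → ℤ) → ℝ) (ξ : R3) :
    HasSum (fun n => c n * unitBump ϕ (ξ - latticePoint n)) (randSymbol ϕ c ξ) :=
  (hϕ.hasSum_randSymbol_finset c ξ).summable.hasSum

lemma IsCutoff.measurable_randSymbol (hϕ : IsCutoff ϕ) (c : (Fin 3 → ℤ) → ℝ) :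
    Measurable (randSymbol ϕ c) := by
  obtain ⟨s, hs⟩ := Filter.exists_seq_tendsto (Filter.atTop : Filter (Finset (Fin 3 → ℤ)))
  refine measurable_of_tendsto_metrizable
    (f := fun k ξ => ∑ n ∈ s k, c n * unitBump ϕ (ξ - latticePoint n)) (fun k => ?_) ?_
  · refine Finset.measurable_fun_sum _ fun n _ => ?_
    exact (hϕ.measurable_unitBump.comp (measurable_id.sub_const _)).const_mul _
  · exact tendsto_pi_nhds.2 fun ξ => (hϕ.hasSum_randSymbol c ξ).comp hs

/-- Cauchy–Schwarz with the weights `φ(ξ - n)`, which sum to `1`. -/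
lemma IsCutoff.enorm_randSymbol_sq_le (hϕ : IsCutoff ϕ) (c : (Fin 3 → ℤ) → ℝ) (ξ : R3) :
    ‖randSymbol ϕ c ξ‖ₑ ^ 2 ≤
      ∑' n, ‖c n‖ₑ ^ 2 * ENNReal.ofReal (unitBump ϕ (ξ - latticePoint n)) := by
  have h1 : (randSymbol ϕ c ξ) ^ 2 ≤
      ∑ n ∈ nearbyLattice ξ, c n ^ 2 * unitBump ϕ (ξ - latticePoint n) := by
    rw [(hϕ.hasSum_randSymbol c ξ).unique (hϕ.hasSum_randSymbol_finset c ξ)]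
    have h2 := Finset.sum_sq_le_sum_mul_sum_of_sq_le_mul (nearbyLattice ξ)
      (r := fun n => c n * unitBump ϕ (ξ - latticePoint n))
      (f := fun n => c n ^ 2 * unitBump ϕ (ξ - latticePoint n))
      (g := fun n => unitBump ϕ (ξ - latticePoint n))
      (fun n _ => mul_nonneg (sq_nonneg _) (hϕ.unitBump_nonneg _))
      (fun n _ => hϕ.unitBump_nonneg _) (fun n _ => le_of_eq (by ring))
    have h3 : ∑ n ∈ nearbyLattice ξ, unitBump ϕ (ξ - latticePoint n) = 1 :=
      (hasSum_sum_of_ne_finset_zero fun n hn => hϕ.unitBump_eq_zero hn).unique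
        (hϕ.hasSum_unitBump ξ)
    rwa [h3, mul_one] at h2
  calc ‖randSymbol ϕ c ξ‖ₑ ^ 2 = ENNReal.ofReal (randSymbol ϕ c ξ ^ 2) := by
        rw [Real.enorm_eq_ofReal_abs, ← ENNReal.ofReal_pow (abs_nonneg _), sq_abs]
    _ ≤ _ := ENNReal.ofReal_le_ofReal h1
    _ = ∑ n ∈ nearbyLattice ξ, ‖c n‖ₑ ^ 2 * ENNReal.ofReal (unitBump ϕ (ξ - latticePoint n)) := by
        rw [ENNReal.ofReal_sum_of_nonneg fun n _ =>
          mul_nonneg (sq_nonneg _) (hϕ.unitBump_nonneg _)]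
        refine Finset.sum_congr rfl fun n _ => ?_
        rw [ENNReal.ofReal_mul (sq_nonneg _), Real.enorm_eq_ofReal_abs,
          ← ENNReal.ofReal_pow (abs_nonneg _), sq_abs]
    _ ≤ _ := ENNReal.sum_le_tsum _

/-- The energy of `φ(D - n) g`, up to constants. -/
def localEnergy (ϕ : R3 → ℝ) (G : R3 → Val d) (n : Fin 3 → ℤ) : ℝ≥0∞ :=
  ∫⁻ ξ, ENNReal.ofReal (unitBump ϕ (ξ - latticePoint n)) * ‖G ξ‖ₑ ^ 2

lemma IsCutoff.measurable_ofReal_unitBump_sub (hϕ : IsCutoff ϕ) (n : Fin 3 → ℤ) :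
    Measurable fun ξ : R3 => ENNReal.ofReal (unitBump ϕ (ξ - latticePoint n)) :=
  (hϕ.measurable_unitBump.comp (measurable_id.sub_const _)).ennreal_ofReal

lemma IsCutoff.tsum_localEnergy (hϕ : IsCutoff ϕ) {G : R3 → Val d}
    (hG : AEStronglyMeasurable G) : ∑' n, localEnergy ϕ G n = ∫⁻ ξ, ‖G ξ‖ₑ ^ 2 := by
  simp only [localEnergy]
  rw [← lintegral_tsum fun n =>
    (hϕ.measurable_ofReal_unitBump_sub n).aemeasurable.fun_mul (hG.enorm.pow_const 2)]
  simp_rw [ENNReal.tsum_mul_right, hϕ.tsum_ofReal_unitBump, one_mul]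

lemma IsCutoff.memLp_randSymbol_smul (hϕ : IsCutoff ϕ) {G : R3 → Val d}
    (hG : AEStronglyMeasurable G) {c : (Fin 3 → ℤ) → ℝ}
    (hc : ∑' n, ‖c n‖ₑ ^ 2 * localEnergy ϕ G n < ∞) :
    MemLp (fun ξ => randSymbol ϕ c ξ • G ξ) 2 volume := by
  refine memLp_two_of_lintegral_lt_top
    ((hϕ.measurable_randSymbol c).aestronglyMeasurable.smul hG) (lt_of_le_of_lt ?_ hc)
  have hm := fun n => (hϕ.measurable_ofReal_unitBump_sub n).aemeasurable.fun_mul (hG.enorm.pow_const 2)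
  calc _ ≤ ∫⁻ ξ, ∑' n, ‖c n‖ₑ ^ 2 *
        (ENNReal.ofReal (unitBump ϕ (ξ - latticePoint n)) * ‖G ξ‖ₑ ^ 2) := by
        refine lintegral_mono fun ξ => ?_
        rw [enorm_smul, mul_pow]
        simp_rw [← mul_assoc]
        rw [ENNReal.tsum_mul_right]
        gcongr
        exact hϕ.enorm_randSymbol_sq_le c ξ
    _ = _ := by
        rw [lintegral_tsum fun n => (hm n).const_mul _]
        refine tsum_congr fun n => ?_
        rw [lintegral_const_mul'' _ (hm n), localEnergy]

/-- Dominated convergence: the sum of the norms of all terms is the symbol built from `|c n|`, times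
`‖K‖`. -/
lemma IsCutoff.hasSum_integral_randSymbol_smul (hϕ : IsCutoff ϕ) {K : R3 → Val d}
    (hK : AEStronglyMeasurable K) {c : (Fin 3 → ℤ) → ℝ}
    (hint : Integrable fun ξ => randSymbol ϕ (fun n => |c n|) ξ • K ξ) :
    HasSum (fun n => ∫ ξ, (c n * unitBump ϕ (ξ - latticePoint n)) • K ξ)
      (∫ ξ, randSymbol ϕ c ξ • K ξ) := by
  refine hasSum_integral_of_dominated_convergence
    (fun n ξ => (|c n| * unitBump ϕ (ξ - latticePoint n)) * ‖K ξ‖) (fun n => ?_) (fun n => ?_)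
    ?_ ?_ ?_
  · exact ((hϕ.measurable_unitBump.comp (measurable_id.sub_const _)).const_mul
      _).aestronglyMeasurable.smul hK
  · refine ae_of_all _ fun ξ => ?_
    rw [norm_smul, norm_mul, Real.norm_eq_abs, Real.norm_of_nonneg (hϕ.unitBump_nonneg _)]
  · exact ae_of_all _ fun ξ => ((hϕ.hasSum_randSymbol _ ξ).mul_right _).summable
  · refine hint.norm.congr (ae_of_all _ fun ξ => ?_)
    simp only
    rw [((hϕ.hasSum_randSymbol _ ξ).mul_right _).tsum_eq, norm_smul, Real.norm_of_nonneg]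
    exact tsum_nonneg fun n => mul_nonneg (abs_nonneg _) (hϕ.unitBump_nonneg _)
  · exact ae_of_all _ fun ξ => (hϕ.hasSum_randSymbol c ξ).smul_const _

lemma enorm_abs_sq (c : ℝ) : ‖|c|‖ₑ ^ 2 = ‖c‖ₑ ^ 2 := by
  rw [← ofReal_norm, ← ofReal_norm, Real.norm_eq_abs, abs_abs, Real.norm_eq_abs]

lemma Represents.fourier_fourierInv {F : R3 → Val d} {v : 𝓢'(R3, Val d)} (h : Represents F v) :
    Represents F (𝓕 (𝓕⁻ v)) := by
  rwa [FourierTransform.fourier_fourierInv_eq]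

/-- The randomization exists for square-summable outcomes of the random coefficients, and its
Fourier transform is given by the randomized symbol. -/
theorem IsCutoff.exists_isRandomization (hϕ : IsCutoff ϕ) {α : ℝ} (hα₀ : 0 ≤ α) (hα : α ≤ 2)
    {f : 𝓢'(R3, Val d)} {F : R3 → Val d} (hF : Represents F (𝓕 f))
    (hG : MemLp (fun ξ => symbolD (-α) ξ • F ξ) 2 volume) {c : (Fin 3 → ℤ) → ℝ}
    (hc : ∑' n, ‖c n‖ₑ ^ 2 * localEnergy ϕ (fun ξ => symbolD (-α) ξ • F ξ) n < ∞) :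
    ∃ f' : 𝓢'(R3, Val d), Represents (fun ξ => randSymbol ϕ c ξ • F ξ) (𝓕 f') ∧
      IsRandomization α ϕ c f f' := by
  set G : R3 → Val d := fun ξ => symbolD (-α) ξ • F ξ with hGdef
  have hG' := hϕ.memLp_randSymbol_smul hG.1 hc
  have hcomm : (fun ξ => symbolD (-α) ξ • randSymbol ϕ c ξ • F ξ) =
      fun ξ => randSymbol ϕ c ξ • G ξ := by
    ext1 ξ
    rw [hGdef, smul_comm]
  -- The Fourier transform of the randomization is `|2πξ|^α` times an `L²` function, hence a
  -- tempered distribution.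
  obtain ⟨v, hv⟩ := exists_represents_symbolD_smul hα₀ hα hG'
    (F := fun ξ => randSymbol ϕ c ξ • F ξ) (by
      filter_upwards [ae_ne_zero] with ξ hξ
      rw [← congrFun hcomm ξ, smul_smul, symbolD_mul_symbolD_neg α hξ, one_smul])
  have hgG := (Represents.memLp_toLp hG).fourier_fourierInv
  have hgG' := (Represents.memLp_toLp hG').fourier_fourierInv
  set g : 𝓢'(R3, Val d) := 𝓕⁻ (Lp.toTemperedDistribution (hG.toLp G)) with hg
  set g' : 𝓢'(R3, Val d) := 𝓕⁻ (Lp.toTemperedDistribution (hG'.toLp _)) with hg'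
  refine ⟨𝓕⁻ v, hv.fourier_fourierInv, ?_, g, g', ⟨F, hF, hgG⟩,
    ⟨_, hv.fourier_fourierInv, by rw [hcomm]; exact hgG'⟩, ?_⟩
  · refine lt_of_le_of_lt (iInf₂_le (fun ξ => randSymbol ϕ c ξ • F ξ) hv.fourier_fourierInv) ?_
    rw [hcomm]
    exact hG'.2
  -- Convergence of distributions is tested on each Schwartz function; Parseval moves the pairing to
  -- frequency space.
  · rw [HasSum, PointwiseConvergenceCLM.tendsto_iff_forall_tendsto]
    intro ψ
    have h1 : HasSum (fun n => ((c n : ℂ) • freqLoc ϕ n g) ψ) (g' ψ) := by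
      have habs : ∑' n, ‖|c n|‖ₑ ^ 2 * localEnergy ϕ G n < ∞ := by simpa only [enorm_abs_sq] using hc
      have hK : AEStronglyMeasurable (fun ξ => (𝓕⁻ ψ) ξ • G ξ) volume :=
        (𝓕⁻ ψ).continuous.aestronglyMeasurable.smul hG.1
      have hint : Integrable fun ξ => randSymbol ϕ (fun n => |c n|) ξ • (𝓕⁻ ψ) ξ • G ξ := by
        have := memLp_one_iff_integrable.1 (MemLp.smul (p := 2) (q := 2) (r := 1)
          (hϕ.memLp_randSymbol_smul hG.1 habs) ((𝓕⁻ ψ).memLp 2 volume))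
        exact this.congr (ae_of_all _ fun ξ => smul_comm ((𝓕⁻ ψ) ξ) _ (G ξ))
      have h2 := hϕ.hasSum_integral_randSymbol_smul hK hint
      have e1 : ∫ ξ, randSymbol ϕ c ξ • (𝓕⁻ ψ) ξ • G ξ = g' ψ := by
        have := (hgG'.2 (𝓕⁻ ψ)).2
        rw [TemperedDistribution.fourier_apply, FourierTransform.fourier_fourierInv_eq] at this
        rw [this]
        refine integral_congr_ae (ae_of_all _ fun ξ => ?_)
        exact smul_comm _ _ _
      have e2 : ∀ n, ∫ ξ, (c n * unitBump ϕ (ξ - latticePoint n)) • (𝓕⁻ ψ) ξ • G ξ =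
          ((c n : ℂ) • freqLoc ϕ n g) ψ := by
        intro n
        have := ((hgG.smul (hϕ.hasTemperateGrowth_unitBump n)).2 (𝓕⁻ ψ)).2
        rw [← TemperedDistribution.fourierInv_apply,
          ← TemperedDistribution.fourierMultiplierCLM_apply] at this
        change _ = (c n : ℂ) • (freqLoc ϕ n g) ψ
        rw [freqLoc, this, ← integral_smul]
        refine integral_congr_ae (ae_of_all _ fun ξ => ?_)
        simp only [mul_smul, Complex.coe_smul]
        congr 1
        exact smul_comm _ _ _
      rw [e1] at h2
      simpa only [e2] using h2
    refine h1.congr fun s => ?_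
    simp

end RandSymbol

/-! ### The heat flow on the whole space -/

section HeatFlow

variable {d : ℕ} {α t : ℝ}

/-- The symbol of `e^{tΔ}`. -/
def heatSymbol (t : ℝ) (ξ : R3) : ℝ := Real.exp (-(4 * Real.pi ^ 2 * ‖ξ‖ ^ 2 * t))

lemma measurable_heatSymbol : Measurable fun z : ℝ × R3 => heatSymbol z.1 z.2 := by
  unfold heatSymbol; fun_prop

lemma heatWeight_eq (α t : ℝ) (ξ : R3) :
    heatWeight α (2 * Real.pi * ‖ξ‖) t = symbolD α ξ * heatSymbol t ξ := by
  rw [heatWeight, symbolD, heatSymbol]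
  congr 3
  ring

/-- The factorization `e^{tΔ} f = (D^α e^{tΔ}) D^{-α} f` on the Fourier side. It can fail only at `ξ
= 0`, a null set. -/
lemma heatSymbol_smul_ae_eq (α t : ℝ) (F : R3 → Val d) :
    (fun ξ => heatSymbol t ξ • F ξ) =ᵐ[volume]
      fun ξ => heatWeight α (2 * Real.pi * ‖ξ‖) t • symbolD (-α) ξ • F ξ := by
  filter_upwards [ae_ne_zero] with ξ hξ
  rw [heatWeight_eq, smul_smul, mul_right_comm, symbolD_mul_symbolD_neg α hξ, one_mul]

lemma heatWeight_le (hα₀ : 0 ≤ α) (hα : α ≤ 2) (ht : 0 < t) {s : ℝ} (hs : 0 ≤ s) :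
    heatWeight α s t ≤ 1 + 1 / t := by
  have h1 := heatWeight_rpow_le hα₀ le_rfl (by simpa using hα) hs ht.le
  rw [Real.rpow_one] at h1
  have h2 : s ^ 2 * t * Real.exp (-(s ^ 2 * t)) ≤ 1 := by
    rw [Real.exp_neg, ← div_eq_mul_inv, div_le_one (Real.exp_pos _)]
    linarith [Real.add_one_le_exp (s ^ 2 * t)]
  have h3 : s ^ 2 * Real.exp (-(s ^ 2 * t)) ≤ 1 / t := by
    rw [le_div_iff₀ ht]; linarith
  linarith

/-- Half of the exponential absorbs `s^α`; the other half is kept as a Gaussian factor, which makes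
the square integrable or summable over frequencies. -/
lemma heatWeight_sq_le (hα₀ : 0 ≤ α) (hα : α ≤ 2) (ht : 0 < t) {s : ℝ} (hs : 0 ≤ s) :
    heatWeight α s t ^ 2 ≤ (1 + 1 / (t / 2)) ^ 2 * Real.exp (-(s ^ 2 * t)) := by
  have h1 : heatWeight α s t = heatWeight α s (t / 2) * Real.exp (-(s ^ 2 * (t / 2))) := by
    rw [heatWeight, heatWeight, mul_assoc (s ^ α), ← Real.exp_add]
    congr 2
    ring
  have h2 := heatWeight_le hα₀ hα (half_pos ht) hs
  have h3 := heatWeight_nonneg (α := α) (t := t / 2) hs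
  have h4 : ((2 : ℕ) : ℝ) * -(s ^ 2 * (t / 2)) = -(s ^ 2 * t) := by push_cast; ring
  rw [h1, mul_pow, ← Real.exp_nat_mul, h4]
  gcongr

lemma memLp_heatWeight (hα₀ : 0 ≤ α) (hα : α ≤ 2) (ht : 0 < t) :
    MemLp (fun ξ : R3 => heatWeight α (2 * Real.pi * ‖ξ‖) t) 2 volume := by
  have hmeas : Measurable fun ξ : R3 => heatWeight α (2 * Real.pi * ‖ξ‖) t := by
    unfold heatWeight; fun_prop
  have hb : 0 < 4 * Real.pi ^ 2 * t := by positivity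
  have hgauss : Integrable fun ξ : R3 => Real.exp (-(4 * Real.pi ^ 2 * t) * ‖ξ‖ ^ 2) := by
    -- A non-integrable function has integral `0` by convention, against the positive value of the
    -- Gaussian integral.
    by_contra h
    have h1 := GaussianFourier.integral_rexp_neg_mul_sq_norm (V := R3) hb
    rw [integral_undef h] at h1
    have : 0 < (Real.pi / (4 * Real.pi ^ 2 * t)) ^ (Module.finrank ℝ R3 / 2 : ℝ) := by positivity
    linarith
  rw [memLp_two_iff_integrable_sq hmeas.aestronglyMeasurable]
  refine (hgauss.const_mul ((1 + 1 / (t / 2)) ^ 2)).mono'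
    (hmeas.pow_const 2).aestronglyMeasurable (ae_of_all _ fun ξ => ?_)
  rw [Real.norm_of_nonneg (sq_nonneg _)]
  refine (heatWeight_sq_le hα₀ hα ht (by positivity)).trans (le_of_eq ?_)
  congr 2
  ring

lemma integrable_heatWeight_smul (hα₀ : 0 ≤ α) (hα : α ≤ 2) (ht : 0 < t) {G : R3 → Val d}
    (hG : MemLp G 2 volume) :
    Integrable fun ξ => heatWeight α (2 * Real.pi * ‖ξ‖) t • G ξ :=
  memLp_one_iff_integrable.1
    (MemLp.smul (p := 2) (q := 2) (r := 1) hG (memLp_heatWeight hα₀ hα ht))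

lemma memLp_heatWeight_smul (hα₀ : 0 ≤ α) (hα : α ≤ 2) (ht : 0 < t) {G : R3 → Val d}
    (hG : MemLp G 2 volume) :
    MemLp (fun ξ => heatWeight α (2 * Real.pi * ‖ξ‖) t • G ξ) 2 volume := by
  have hmeas : Measurable fun ξ : R3 => heatWeight α (2 * Real.pi * ‖ξ‖) t := by
    unfold heatWeight; fun_prop
  refine hG.of_le_mul (c := 1 + 1 / t) (hmeas.aestronglyMeasurable.smul hG.1)
    (ae_of_all _ fun ξ => ?_)
  have hs : 0 ≤ 2 * Real.pi * ‖ξ‖ := by positivity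
  rw [norm_smul, Real.norm_of_nonneg (heatWeight_nonneg hs)]
  gcongr
  exact heatWeight_le hα₀ hα ht hs

lemma integrable_heatSymbol_smul (hα₀ : 0 ≤ α) (hα : α ≤ 2) (ht : 0 < t) {F : R3 → Val d}
    (hG : MemLp (fun ξ => symbolD (-α) ξ • F ξ) 2 volume) :
    Integrable fun ξ => heatSymbol t ξ • F ξ :=
  (integrable_heatWeight_smul hα₀ hα ht hG).congr (heatSymbol_smul_ae_eq α t F).symm

lemma memLp_heatSymbol_smul (hα₀ : 0 ≤ α) (hα : α ≤ 2) (ht : 0 < t) {F : R3 → Val d}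
    (hG : MemLp (fun ξ => symbolD (-α) ξ • F ξ) 2 volume) :
    MemLp (fun ξ => heatSymbol t ξ • F ξ) 2 volume :=
  (memLp_heatWeight_smul hα₀ hα ht hG).ae_eq (heatSymbol_smul_ae_eq α t F).symm

lemma Represents.heat {F : R3 → Val d} {f : 𝓢'(R3, Val d)} (h : Represents F (𝓕 f)) (ht : 0 ≤ t)
    (hint : Integrable fun ξ => heatSymbol t ξ • F ξ) :
    Represents (𝓕⁻ fun ξ => heatSymbol t ξ • F ξ) (RandomHeat.heat t f) := by
  have h1 := h.smul (hasTemperateGrowth_heatSymbol ht)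
  have e : (fun ξ => ((Real.exp (-(4 * Real.pi ^ 2 * ‖ξ‖ ^ 2 * t)) : ℝ) : ℂ) • F ξ) =
      fun ξ => heatSymbol t ξ • F ξ := by
    ext1 ξ
    rw [Complex.coe_smul, heatSymbol]
  rw [e] at h1
  exact h1.fourierInv hint

/-- The `L²` norm of `e^{tΔ} f`, squared, is an integral over frequencies. -/
lemma lintegral_heatSymbol_energy_lt_top {p : ℝ} (hα₀ : 0 ≤ α) (hp : 2 ≤ p) (hαp : α * p ≤ 2)
    {F : R3 → Val d} (hG : MemLp (fun ξ => symbolD (-α) ξ • F ξ) 2 volume) :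
    ∫⁻ t in Set.Icc (0 : ℝ) 1, (∫⁻ ξ, ‖heatSymbol t ξ • F ξ‖ₑ ^ 2) ^ (p / 2) < ∞ := by
  -- The finite energy distribution of `D^{-α} f` over frequencies.
  set ν := (volume : Measure R3).withDensity fun ξ => ‖symbolD (-α) ξ • F ξ‖ₑ ^ 2 with hν
  have : IsFiniteMeasure ν := isFiniteMeasure_withDensity (lintegral_lt_top_of_memLp_two hG).ne
  have hs : Measurable fun ξ : R3 => 2 * Real.pi * ‖ξ‖ := by fun_prop
  have h := lintegral_heatEnergy_rpow_lt_top ν hs (fun ξ => by positivity) hα₀ hp hαp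
  refine lt_of_le_of_lt (le_of_eq ?_) h
  refine lintegral_congr fun t => ?_
  congr 1
  have hm : Measurable fun ξ : R3 =>
      ENNReal.ofReal (heatWeight α (2 * Real.pi * ‖ξ‖) t) ^ (2 : ℝ) := by
    unfold heatWeight; fun_prop
  rw [hν, lintegral_withDensity_eq_lintegral_mul₀ (hG.1.enorm.pow_const 2) hm.aemeasurable]
  refine lintegral_congr_ae ?_
  filter_upwards [heatSymbol_smul_ae_eq α t F] with ξ hξ
  rw [hξ, enorm_smul, mul_pow, Pi.mul_apply, mul_comm, Real.enorm_of_nonneg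
    (heatWeight_nonneg (by positivity)), ENNReal.rpow_two]

lemma stronglyMeasurable_fourierInv {m : ℝ → R3 → ℝ} (hm : Measurable fun z : ℝ × R3 => m z.1 z.2)
    {F : R3 → Val d} (hF : StronglyMeasurable F) :
    StronglyMeasurable fun z : ℝ × R3 => 𝓕⁻ (fun ξ => m z.1 ξ • F ξ) z.2 := by
  simp_rw [Real.fourierInv_eq']
  refine StronglyMeasurable.integral_prod_right
    (f := fun (z : ℝ × R3) (ξ : R3) =>
      Complex.exp (↑(2 * Real.pi * inner ℝ ξ z.2) * Complex.I) • m z.1 ξ • F ξ) ?_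
  have h1 : StronglyMeasurable fun z : (ℝ × R3) × R3 =>
      Complex.exp (↑(2 * Real.pi * inner ℝ z.2 z.1.2) * Complex.I) := by
    have : Measurable fun z : (ℝ × R3) × R3 => inner ℝ z.2 z.1.2 :=
      measurable_snd.inner (measurable_snd.comp measurable_fst)
    exact Measurable.stronglyMeasurable (by fun_prop)
  have h2 : StronglyMeasurable fun z : (ℝ × R3) × R3 => m z.1.1 z.2 :=
    (hm.comp (by fun_prop :
      Measurable fun z : (ℝ × R3) × R3 => (z.1.1, z.2))).stronglyMeasurable
  exact h1.smul (h2.smul (hF.comp_measurable measurable_snd))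

end HeatFlow

/-! ### Frequency-localized pieces of the heat flow -/

section Pieces

variable {ϕ : R3 → ℝ} {d : ℕ} {α : ℝ}

/-- The symbol of `e^{tΔ} φ(D - n)`. -/
def pieceSymbol (ϕ : R3 → ℝ) (n : Fin 3 → ℤ) (t : ℝ) (ξ : R3) : ℝ :=
  unitBump ϕ (ξ - latticePoint n) * heatSymbol t ξ

/-- The function `e^{tΔ} φ(D - n) f` of time and space, where `F` is the Fourier transform of
`f`. -/
def heatPiece (ϕ : R3 → ℝ) (F : R3 → Val d) (n : Fin 3 → ℤ) (z : ℝ × R3) : Val d :=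
  𝓕⁻ (fun ξ => pieceSymbol ϕ n z.1 ξ • F ξ) z.2

lemma IsCutoff.stronglyMeasurable_heatPiece (hϕ : IsCutoff ϕ) {F : R3 → Val d}
    (hF : StronglyMeasurable F) (n : Fin 3 → ℤ) : StronglyMeasurable (heatPiece ϕ F n) := by
  refine stronglyMeasurable_fourierInv (m := pieceSymbol ϕ n) ?_ hF
  exact (hϕ.measurable_unitBump.comp (measurable_snd.sub_const _)).mul measurable_heatSymbol

lemma IsCutoff.enorm_pieceSymbol_smul (hϕ : IsCutoff ϕ) (F : R3 → Val d) (n : Fin 3 → ℤ) (t : ℝ)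
    (ξ : R3) : ‖pieceSymbol ϕ n t ξ • F ξ‖ₑ =
      ENNReal.ofReal (unitBump ϕ (ξ - latticePoint n)) * ‖heatSymbol t ξ • F ξ‖ₑ := by
  rw [pieceSymbol, mul_smul, enorm_smul, Real.enorm_of_nonneg (hϕ.unitBump_nonneg _)]

/-- Bernstein's inequality for a frequency-localized piece. -/
lemma IsCutoff.enorm_heatPiece_sq_le (hϕ : IsCutoff ϕ) {F : R3 → Val d}
    (hF : StronglyMeasurable F) (n : Fin 3 → ℤ) (t : ℝ) (x : R3) :
    ‖heatPiece ϕ F n (t, x)‖ₑ ^ 2 ≤ (∫⁻ ξ, ENNReal.ofReal (unitBump ϕ ξ)) *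
      localEnergy ϕ (fun ξ => heatSymbol t ξ • F ξ) n := by
  set ν := (volume : Measure R3).withDensity
    fun ξ => ENNReal.ofReal (unitBump ϕ (ξ - latticePoint n)) with hν
  have hνuniv : ν Set.univ = ∫⁻ ξ, ENNReal.ofReal (unitBump ϕ ξ) := by
    rw [hν, withDensity_apply _ MeasurableSet.univ, Measure.restrict_univ, lintegral_unitBump_sub]
  have : IsFiniteMeasure ν := ⟨by rw [hνuniv]; exact hϕ.lintegral_unitBump_lt_top⟩
  have hm : Measurable fun ξ => ‖heatSymbol t ξ • F ξ‖ₑ :=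
    ((measurable_heatSymbol.comp measurable_prodMk_left).stronglyMeasurable.smul hF).enorm
  -- Cauchy–Schwarz against `φ(ξ - n) dξ`, whose total mass does not depend on `n`.
  have h1 := rpow_lintegral_le ν hm.aemeasurable one_le_two
  rw [hνuniv, hν, lintegral_withDensity_eq_lintegral_mul _ (hϕ.measurable_ofReal_unitBump_sub n) hm,
    lintegral_withDensity_eq_lintegral_mul _ (hϕ.measurable_ofReal_unitBump_sub n)
      (hm.pow_const _)] at h1
  norm_num at h1
  refine le_trans ?_ h1
  gcongr
  refine (enorm_fourierInv_le _ _).trans (le_of_eq ?_)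
  simp_rw [hϕ.enorm_pieceSymbol_smul]

lemma IsCutoff.tsum_enorm_heatPiece_sq_le (hϕ : IsCutoff ϕ) {F : R3 → Val d}
    (hF : StronglyMeasurable F) (t : ℝ) (x : R3) :
    ∑' n, ‖heatPiece ϕ F n (t, x)‖ₑ ^ 2 ≤ (∫⁻ ξ, ENNReal.ofReal (unitBump ϕ ξ)) *
      ∫⁻ ξ, ‖heatSymbol t ξ • F ξ‖ₑ ^ 2 := by
  have hm : StronglyMeasurable fun ξ => heatSymbol t ξ • F ξ :=
    (measurable_heatSymbol.comp measurable_prodMk_left).stronglyMeasurable.smul hF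
  rw [← hϕ.tsum_localEnergy hm.aestronglyMeasurable, ← ENNReal.tsum_mul_left]
  exact ENNReal.tsum_le_tsum fun n => hϕ.enorm_heatPiece_sq_le hF n t x

lemma IsCutoff.lintegral_tsum_enorm_heatPiece_sq_le (hϕ : IsCutoff ϕ) (hα₀ : 0 ≤ α) (hα : α ≤ 2)
    {F : R3 → Val d} (hF : StronglyMeasurable F)
    (hG : MemLp (fun ξ => symbolD (-α) ξ • F ξ) 2 volume) {t : ℝ} (ht : 0 < t) :
    ∫⁻ x, ∑' n, ‖heatPiece ϕ F n (t, x)‖ₑ ^ 2 ≤ ∫⁻ ξ, ‖heatSymbol t ξ • F ξ‖ₑ ^ 2 := by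
  have hm : StronglyMeasurable fun ξ => heatSymbol t ξ • F ξ :=
    (measurable_heatSymbol.comp measurable_prodMk_left).stronglyMeasurable.smul hF
  have hb : ∀ n ξ, ‖unitBump ϕ (ξ - latticePoint n)‖ ≤ 1 := fun n ξ => by
    rw [Real.norm_of_nonneg (hϕ.unitBump_nonneg _)]; exact hϕ.unitBump_le_one _
  have hbm : ∀ n, Measurable fun ξ : R3 => unitBump ϕ (ξ - latticePoint n) := fun n =>
    hϕ.measurable_unitBump.comp (measurable_id.sub_const _)
  have hle : ∀ n ξ, ‖pieceSymbol ϕ n t ξ • F ξ‖ ≤ ‖heatSymbol t ξ • F ξ‖ := by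
    intro n ξ
    rw [pieceSymbol, mul_smul, norm_smul]
    exact mul_le_of_le_one_left (norm_nonneg _) (hb n ξ)
  have hpm : ∀ n, AEStronglyMeasurable (fun ξ => pieceSymbol ϕ n t ξ • F ξ) volume := by
    intro n
    simp_rw [pieceSymbol, mul_smul]
    exact ((hbm n).stronglyMeasurable.smul hm).aestronglyMeasurable
  have hsq : ∀ n, AEMeasurable (fun x => ‖heatPiece ϕ F n (t, x)‖ₑ ^ 2) volume := fun n =>
    (((hϕ.stronglyMeasurable_heatPiece hF n).comp_measurable
      measurable_prodMk_left).enorm.pow_const 2).aemeasurable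
  rw [lintegral_tsum hsq, ← hϕ.tsum_localEnergy hm.aestronglyMeasurable]
  refine ENNReal.tsum_le_tsum fun n => ?_
  simp only [heatPiece]
  rw [lintegral_enorm_fourierInv_sq
    ((integrable_heatSymbol_smul hα₀ hα ht hG).mono (hpm n) (ae_of_all _ (hle n)))
    ((memLp_heatSymbol_smul hα₀ hα ht hG).of_le (hpm n) (ae_of_all _ (hle n)))]
  refine lintegral_mono fun ξ => ?_
  simp only
  rw [hϕ.enorm_pieceSymbol_smul, mul_pow]
  gcongr
  -- Plancherel produces `φ²`, while `localEnergy` carries `φ`; `0 ≤ φ ≤ 1` compares them.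
  exact pow_le_of_le_one zero_le (ENNReal.ofReal_le_one.2 (hϕ.unitBump_le_one _)) two_ne_zero

/-- The randomized heat flow is the Gaussian series of the pieces. -/
lemma IsCutoff.hasSum_heatPiece (hϕ : IsCutoff ϕ) (hα₀ : 0 ≤ α) (hα : α ≤ 2)
    {F : R3 → Val d} (hF : StronglyMeasurable F)
    (hG : MemLp (fun ξ => symbolD (-α) ξ • F ξ) 2 volume) {c : (Fin 3 → ℤ) → ℝ}
    (hc : ∑' n, ‖c n‖ₑ ^ 2 * localEnergy ϕ (fun ξ => symbolD (-α) ξ • F ξ) n < ∞) {t : ℝ}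
    (ht : 0 < t) (x : R3) :
    HasSum (fun n => (c n : ℂ) • heatPiece ϕ F n (t, x))
      (𝓕⁻ (fun ξ => heatSymbol t ξ • randSymbol ϕ c ξ • F ξ) x) := by
  have hm : StronglyMeasurable fun ξ => heatSymbol t ξ • F ξ :=
    (measurable_heatSymbol.comp measurable_prodMk_left).stronglyMeasurable.smul hF
  -- For fixed `x` the character is absorbed into the integrand, so evaluation at `x` is an integral
  -- against the randomized symbol.
  set K : R3 → Val d := fun ξ => Real.fourierChar (inner ℝ ξ x) • heatSymbol t ξ • F ξ with hKdef
  have hch : Continuous fun ξ : R3 => Real.fourierChar (inner ℝ ξ x) :=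
    Real.continuous_fourierChar.comp (by fun_prop)
  have hK : AEStronglyMeasurable K volume := by
    simp_rw [hKdef, Circle.smul_def]
    exact (continuous_subtype_val.comp hch).aestronglyMeasurable.smul hm.aestronglyMeasurable
  have habs : ∑' n, ‖|c n|‖ₑ ^ 2 * localEnergy ϕ (fun ξ => symbolD (-α) ξ • F ξ) n < ∞ := by
    simpa only [enorm_abs_sq] using hc
  have hG' := hϕ.memLp_randSymbol_smul hG.1 habs
  have hG'' : MemLp (fun ξ => symbolD (-α) ξ • randSymbol ϕ (fun n => |c n|) ξ • F ξ) 2 volume := by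
    refine hG'.ae_eq (ae_of_all _ fun ξ => ?_)
    exact smul_comm _ _ _
  have hint : Integrable fun ξ => randSymbol ϕ (fun n => |c n|) ξ • K ξ := by
    refine (integrable_heatSymbol_smul hα₀ hα ht hG'').mono
      ((hϕ.measurable_randSymbol _).aestronglyMeasurable.smul hK) (ae_of_all _ fun ξ => le_of_eq ?_)
    simp only [hKdef, norm_smul, Circle.norm_smul]
    ring
  convert hϕ.hasSum_integral_randSymbol_smul hK hint using 1
  · ext1 n
    rw [heatPiece, Real.fourierInv_eq, Complex.coe_smul, ← integral_smul]
    refine integral_congr_ae (ae_of_all _ fun ξ => ?_)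
    simp only [hKdef, pieceSymbol, Circle.smul_def]
    simp only [← Complex.coe_smul, smul_smul]
    congr 1
    push_cast
    ring
  · rw [Real.fourierInv_eq]
    refine integral_congr_ae (ae_of_all _ fun ξ => ?_)
    simp only [hKdef, Circle.smul_def]
    simp only [← Complex.coe_smul, smul_smul]
    congr 1
    ring

end Pieces

/-! ### The randomized heat flow on the whole space -/

section MixedNorm

variable {X : Type*} [MeasurableSpace X] {μ : Measure X} [SFinite μ] {d : ℕ}

lemma lintegral_mixed_interpolate {w : ℝ → X → Val d}
    (hw : StronglyMeasurable fun z : ℝ × X => w z.1 z.2) {p q Q : ℝ} (hp : 2 ≤ p) (hq : 2 ≤ q)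
    (hqQ : q ≤ Q)
    (h₂ : ∫⁻ t in Set.Icc (0 : ℝ) 1, (∫⁻ x, ‖w t x‖ₑ ^ 2 ∂μ) ^ (p / 2) < ∞)
    (hQ : ∫⁻ t in Set.Icc (0 : ℝ) 1, (∫⁻ x, ‖w t x‖ₑ ^ Q ∂μ) ^ (p / Q) < ∞) :
    ∫⁻ t in Set.Icc (0 : ℝ) 1, (∫⁻ x, ‖w t x‖ₑ ^ q ∂μ) ^ (p / q) < ∞ := by
  have hp0 : 0 < p := by linarith
  have hm : Measurable fun t => (∫⁻ x, ‖w t x‖ₑ ^ 2 ∂μ) ^ (p / 2) :=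
    ((hw.enorm.pow_const 2).lintegral_prod_right').pow_const _
  calc _ ≤ ∫⁻ t in Set.Icc (0 : ℝ) 1, (2 : ℝ≥0∞) ^ p * (2 ^ (p - 1) *
        ((∫⁻ x, ‖w t x‖ₑ ^ 2 ∂μ) ^ (p / 2) + (∫⁻ x, ‖w t x‖ₑ ^ Q ∂μ) ^ (p / Q))) := by
        refine lintegral_mono fun t => ?_
        have hmt : Measurable fun x => ‖w t x‖ₑ :=
          (hw.comp_measurable (measurable_prodMk_left (x := t))).enorm
        have h1 := ENNReal.rpow_le_rpow
          (lintegral_rpow_le_interpolate μ hmt.aemeasurable hq hqQ) hp0.le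
        rw [← ENNReal.rpow_mul, ENNReal.mul_rpow_of_nonneg _ _ hp0.le] at h1
        have h2 : 1 / q * p = p / q := by ring
        rw [h2] at h1
        refine h1.trans ?_
        gcongr
        refine (ENNReal.rpow_add_le_mul_rpow_add_rpow _ _ (by linarith)).trans (le_of_eq ?_)
        rw [← ENNReal.rpow_mul, ← ENNReal.rpow_mul]
        simp_rw [ENNReal.rpow_two]
        rw [show 1 / 2 * p = p / 2 by ring, show 1 / Q * p = p / Q by ring]
    _ = (2 : ℝ≥0∞) ^ p * (2 ^ (p - 1) *
        ((∫⁻ t in Set.Icc (0 : ℝ) 1, (∫⁻ x, ‖w t x‖ₑ ^ 2 ∂μ) ^ (p / 2)) +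
          ∫⁻ t in Set.Icc (0 : ℝ) 1, (∫⁻ x, ‖w t x‖ₑ ^ Q ∂μ) ^ (p / Q))) := by
        rw [lintegral_const_mul' _ _ (ENNReal.rpow_ne_top_of_nonneg hp0.le (by simp)),
          lintegral_const_mul' _ _ (ENNReal.rpow_ne_top_of_nonneg (by linarith) (by simp)),
          lintegral_add_left hm]
    _ < ∞ := by
        have h1 : (2 : ℝ≥0∞) ^ p < ∞ := ENNReal.rpow_lt_top_of_nonneg hp0.le (by simp)
        have h2 : (2 : ℝ≥0∞) ^ (p - 1) < ∞ := ENNReal.rpow_lt_top_of_nonneg (by linarith) (by simp)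
        exact ENNReal.mul_lt_top h1 (ENNReal.mul_lt_top h2 (ENNReal.add_lt_top.2 ⟨h₂, hQ⟩))

end MixedNorm

/-! ### Almost sure bounds and good sets on the whole space -/

section WholeSpaceMain

variable {Ω : Type*} [MeasurableSpace Ω] {P : Measure Ω} [IsProbabilityMeasure P]
  {ϕ : R3 → ℝ} {d : ℕ} {α : ℝ} {h : (Fin 3 → ℤ) → Ω → ℝ} {v : ℝ≥0}

/-- The heat flow of the distribution with Fourier transform `∑ c_n φ(ξ - n) F`. -/
def randHeat (ϕ : R3 → ℝ) (F : R3 → Val d) (c : (Fin 3 → ℤ) → ℝ) (t : ℝ) (x : R3) : Val d :=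
  𝓕⁻ (fun ξ => heatSymbol t ξ • randSymbol ϕ c ξ • F ξ) x

lemma IsCutoff.stronglyMeasurable_randHeat (hϕ : IsCutoff ϕ) {F : R3 → Val d}
    (hF : StronglyMeasurable F) (c : (Fin 3 → ℤ) → ℝ) :
    StronglyMeasurable fun z : ℝ × R3 => randHeat ϕ F c z.1 z.2 :=
  stronglyMeasurable_fourierInv measurable_heatSymbol
    ((hϕ.measurable_randSymbol c).stronglyMeasurable.smul hF)

theorem IsCutoff.ae_lintegral_randHeat_lt_top (hϕ : IsCutoff ϕ)
    (hlaw : ∀ n, HasLaw (h n) (gaussianReal 0 v) P) (hind : iIndepFun h P) (hα₀ : 0 ≤ α)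
    (hα : α ≤ 2) {p q : ℝ} (hp : 2 ≤ p) (hq : 2 ≤ q) (hαp : α * p ≤ 2) {F : R3 → Val d}
    (hF : StronglyMeasurable F) (hG : MemLp (fun ξ => symbolD (-α) ξ • F ξ) 2 volume) :
    ∀ᵐ ω ∂P, ∑' n, ‖h n ω‖ₑ ^ 2 * localEnergy ϕ (fun ξ => symbolD (-α) ξ • F ξ) n < ∞ →
      ∫⁻ t in Set.Icc (0 : ℝ) 1,
        (∫⁻ x, ‖randHeat ϕ F (fun n => h n ω) t x‖ₑ ^ q) ^ (p / q) < ∞ := by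
  set V := ∫⁻ ξ, ENNReal.ofReal (unitBump ϕ ξ) with hV
  have hVtop : V < ∞ := hϕ.lintegral_unitBump_lt_top
  set E : ℝ → ℝ≥0∞ := fun t => ∫⁻ ξ, ‖heatSymbol t ξ • F ξ‖ₑ ^ 2 with hE
  have hp2 : 0 ≤ p / 2 := by linarith
  have h1 := ae_lintegral_gaussian_series_lt_top hlaw hind (volume : Measure R3) hp
    (le_max_left p q) (u := heatPiece ϕ F) (hϕ.stronglyMeasurable_heatPiece hF)
    -- `V` serves the uniform bound (Bernstein), `1` serves the `L¹` bound (Plancherel).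
    (B := fun t => (V + 1) * E t)
    (fun t _ => ae_of_all _ fun x => (hϕ.tsum_enorm_heatPiece_sq_le hF t x).trans
      (mul_le_mul_left le_self_add _))
    (fun t ht => (hϕ.lintegral_tsum_enorm_heatPiece_sq_le hα₀ hα hF hG ht).trans
      (le_mul_of_one_le_left zero_le le_add_self))
    (by
      simp_rw [ENNReal.mul_rpow_of_nonneg _ _ hp2]
      have hc : (V + 1) ^ (p / 2) ≠ ∞ :=
        ENNReal.rpow_ne_top_of_nonneg hp2 (ENNReal.add_lt_top.2 ⟨hVtop, ENNReal.one_lt_top⟩).ne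
      rw [lintegral_const_mul' _ _ hc]
      exact ENNReal.mul_lt_top hc.lt_top (lintegral_heatSymbol_energy_lt_top hα₀ hp hαp hG))
    (fun t ht => (ENNReal.mul_lt_top (ENNReal.add_lt_top.2 ⟨hVtop, ENNReal.one_lt_top⟩)
      (lintegral_lt_top_of_memLp_two (memLp_heatSymbol_smul hα₀ hα ht hG))).ne)
  filter_upwards [h1] with ω hω hc
  have hQ := hω (randHeat ϕ F fun n => h n ω) fun t ht =>
    ae_of_all _ fun x => hϕ.hasSum_heatPiece hα₀ hα hF hG hc ht x
  -- For this outcome the random datum lies in `Ḣ^{-α}`, so its `L^p_t L²_x` norm is finite by the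
  -- deterministic energy estimate: the lower endpoint of the interpolation.
  have hG' : MemLp (fun ξ => symbolD (-α) ξ • randSymbol ϕ (fun n => h n ω) ξ • F ξ) 2 volume :=
    (hϕ.memLp_randSymbol_smul hG.1 hc).ae_eq (ae_of_all _ fun ξ => smul_comm _ _ _)
  refine lintegral_mixed_interpolate (hϕ.stronglyMeasurable_randHeat hF _) hp hq
    (le_max_right p q) ?_ hQ
  refine lt_of_le_of_lt (le_of_eq ?_) (lintegral_heatSymbol_energy_lt_top hα₀ hp hαp hG')
  refine lintegral_congr_ae ?_
  filter_upwards [ae_pos_restrict_Icc 1] with t ht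
  simp only [randHeat]
  rw [lintegral_enorm_fourierInv_sq (integrable_heatSymbol_smul hα₀ hα ht hG')
    (memLp_heatSymbol_smul hα₀ hα ht hG')]

/-- All representatives agree almost everywhere and the symbol vanishes at most at `ξ = 0`; without
a representative the infimum is `∞`. -/
lemma hdotNorm_ne_zero {s : ℝ} {f : 𝓢'(R3, Val d)} (hf : f ≠ 0) : hdotNorm s f ≠ 0 := by
  intro h0
  by_cases hex : ∃ F, Represents F (𝓕 f)
  · obtain ⟨F, hF⟩ := hex
    have h1 : eLpNorm (fun ξ => symbolD s ξ • F ξ) 2 volume ≤ hdotNorm s f := by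
      refine le_iInf₂ fun F' hF' => le_of_eq (eLpNorm_congr_ae ?_)
      filter_upwards [hF.ae_eq hF'] with ξ hξ
      rw [hξ]
    rw [h0, nonpos_iff_eq_zero, eLpNorm_eq_zero_iff _ two_ne_zero] at h1
    · have h2 : F =ᵐ[volume] 0 := by
        filter_upwards [h1, ae_ne_zero] with ξ hξ hξ0
        have h3 := symbolD_mul_symbolD_neg s hξ0
        exact (smul_eq_zero.1 hξ).resolve_left (left_ne_zero_of_mul_eq_one h3)
      have h3 := hF.congr_ae h2
      have h4 : 𝓕 f = 0 := by
        ext1 ψ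
        rw [(h3.2 ψ).2]
        simp
      apply hf
      have h5 : 𝓕⁻ (𝓕 f) = f := FourierTransform.fourierInv_fourier_eq f
      rw [← h5, h4]
      ext1 ψ
      rfl
    · exact (measurable_symbolD s).aestronglyMeasurable.smul hF.1.aestronglyMeasurable
  · push Not at hex
    simp [hdotNorm, hex] at h0

theorem exists_goodSet_wholeSpace (hϕ : IsCutoff ϕ)
    (hlaw : ∀ n, HasLaw (h n) (gaussianReal 0 v) P) (hind : iIndepFun h P) (hα₀ : 0 ≤ α)
    (hα : α ≤ 2) {p₁ p₂ q₁ q₂ : ℝ} (hp₁ : 2 ≤ p₁) (hp₂ : 2 ≤ p₂) (hq₁ : 2 ≤ q₁) (hq₂ : 2 ≤ q₂)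
    (hαp₁ : α * p₁ ≤ 2) (hαp₂ : α * p₂ ≤ 2) {f : 𝓢'(R3, Val d)} (hf : hdotNorm (-α) f < ∞)
    (hf₀ : f ≠ 0) :
    ∀ᵐ ω ∂P, ∀ lam : ℝ, 0 < lam → ∃ δ : ℝ, 0 < δ ∧ ∃ M : ℝ, 0 < M ∧
      ω ∈ goodSet α ϕ h f p₁ q₁ M δ ∩ goodSet α ϕ h f p₂ q₂ lam δ := by
  -- A strongly measurable representative is chosen, for joint measurability of the flow in time and
  -- space.
  obtain ⟨F, hF, hFm, hG⟩ : ∃ F : R3 → Val d, Represents F (𝓕 f) ∧ StronglyMeasurable F ∧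
      MemLp (fun ξ => symbolD (-α) ξ • F ξ) 2 volume := by
    simp only [hdotNorm, iInf_lt_iff] at hf
    obtain ⟨F, hF, hlt⟩ := hf
    have hm := hF.1.aestronglyMeasurable
    refine ⟨hm.mk F, hF.congr_ae hm.ae_eq_mk, hm.stronglyMeasurable_mk, ?_⟩
    refine MemLp.ae_eq ?_ ⟨(measurable_symbolD (-α)).aestronglyMeasurable.smul hm, hlt⟩
    filter_upwards [hm.ae_eq_mk] with ξ hξ
    rw [Pi.smul_apply', hξ]
  have hsum : ∑' n, localEnergy ϕ (fun ξ => symbolD (-α) ξ • F ξ) n ≠ ∞ := by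
    rw [hϕ.tsum_localEnergy hG.1]
    exact (lintegral_lt_top_of_memLp_two hG).ne
  filter_upwards [ae_tsum_gaussian_sq_lt_top hlaw hsum,
    hϕ.ae_lintegral_randHeat_lt_top hlaw hind hα₀ hα hp₁ hq₁ hαp₁ hFm hG,
    hϕ.ae_lintegral_randHeat_lt_top hlaw hind hα₀ hα hp₂ hq₂ hαp₂ hFm hG] with ω hc h1 h2 lam hlam
  obtain ⟨f', hf', hrand⟩ := hϕ.exists_isRandomization hα₀ hα hF hG hc
  have hG' : MemLp (fun ξ => symbolD (-α) ξ • randSymbol ϕ (fun n => h n ω) ξ • F ξ) 2 volume :=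
    (hϕ.memLp_randSymbol_smul hG.1 hc).ae_eq (ae_of_all _ fun ξ => smul_comm _ _ _)
  obtain ⟨δ, hδ, M, hM, hn1, hn2⟩ := exists_timeSpaceNorm_lt
    (rep := fun t u => Represents u (heat t f')) (w := randHeat ϕ F fun n => h n ω)
    (p₁ := p₁) (p₂ := p₂) (q₁ := q₁) (q₂ := q₂) (by linarith) (by linarith) (by linarith)
    (by linarith) (hϕ.stronglyMeasurable_randHeat hFm _).aestronglyMeasurable
    (fun t ht => hf'.heat ht.le (integrable_heatSymbol_smul hα₀ hα ht hG')) (h1 hc) (h2 hc)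
    (hdotNorm_ne_zero (s := -α) hf₀) hlam
  exact ⟨δ, hδ, M, hM, ⟨f', hrand, hn1⟩, ⟨f', hrand, hn2⟩⟩

end WholeSpaceMain

/-! ### Expansions in two orthonormal bases -/

section HilbertBasis

lemma hasSum_val {γ : Type*} {d : ℕ} {F : γ → Val d} {y : Val d}
    (h : ∀ j, HasSum (fun i => F i j) (y j)) : HasSum F y :=
  ((PiLp.continuousLinearEquiv 2 ℂ fun _ : Fin d => ℂ).toHomeomorph.isInducing.hasSum_iff
    (g := (PiLp.continuousLinearEquiv 2 ℂ fun _ : Fin d => ℂ)) _ _).1 (Pi.hasSum.2 h)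

variable {H : Type*} [NormedAddCommGroup H] [InnerProductSpace ℂ H] {ι κ : Type*} {d : ℕ}

/-- A square-summable family of coefficients with respect to one orthonormal basis is expanded with
respect to another one. -/
lemma exists_change_hilbertBasis (e : HilbertBasis ι ℂ H) (f : HilbertBasis κ ℂ H)
    {b : ι → Val d} (hb : Summable fun n => ‖b n‖ ^ 2) :
    ∃ β : κ → Val d, (Summable fun k => ‖β k‖ ^ 2) ∧
      (∀ k, HasSum (fun n => inner ℂ (f k) (e n) • b n) (β k)) ∧
      ∀ n, HasSum (fun k => inner ℂ (e n) (f k) • β k) (b n) := by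
  have hbj : ∀ j, Memℓp (fun n => b n j) (2 : ℝ≥0∞) := by
    intro j
    refine memℓp_gen ?_
    simp only [ENNReal.toReal_ofNat, Real.rpow_two]
    refine hb.of_nonneg_of_le (fun n => sq_nonneg _) fun n => ?_
    gcongr
    exact PiLp.norm_apply_le (b n) j
  -- Vector coefficients are treated coordinatewise: each coordinate is an `ℓ²` sequence, hence a
  -- vector `g j` of the Hilbert space.
  let x : Fin d → lp (fun _ : ι => ℂ) 2 := fun j => ⟨fun n => b n j, hbj j⟩
  let g : Fin d → H := fun j => e.repr.symm (x j)
  refine ⟨fun k => WithLp.toLp 2 fun j => f.repr (g j) k, ?_, fun k => hasSum_val fun j => ?_,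
    fun n => hasSum_val fun j => ?_⟩
  · simp only [EuclideanSpace.norm_sq_eq]
    refine summable_sum fun j _ => ?_
    have := (lp.memℓp (f.repr (g j))).summable (by simp)
    simpa using this
  · have h1 := (e.hasSum_repr_symm (x j)).mapL (innerSL ℂ (f k))
    simp only [innerSL_apply_apply, inner_smul_right] at h1
    simp only [PiLp.smul_apply, smul_eq_mul, f.repr_apply_apply, g]
    refine h1.congr_fun ?_
    intro n
    simp only [x]
    ring
  · have h1 := (f.hasSum_repr (g j)).mapL (innerSL ℂ (e n))
    simp only [innerSL_apply_apply, inner_smul_right] at h1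
    have h2 : inner ℂ (e n) (g j) = b n j := by
      rw [← e.repr_apply_apply, LinearIsometryEquiv.apply_symm_apply]
    rw [h2] at h1
    refine h1.congr_fun fun k => ?_
    simp only [PiLp.smul_apply, smul_eq_mul]
    ring

lemma tsum_enorm_inner_sq (b : HilbertBasis ι ℂ H) {x : H} (hx : ‖x‖ = 1) :
    ∑' i, ‖inner ℂ (b i) x‖ₑ ^ 2 = 1 := by
  have h := lp.hasSum_norm (p := 2) (by simp) (b.repr x)
  simp only [ENNReal.toReal_ofNat, Real.rpow_two, LinearIsometryEquiv.norm_map, hx, one_pow,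
    b.repr_apply_apply] at h
  have h2 := ENNReal.ofReal_tsum_of_nonneg (fun i => sq_nonneg _) h.summable
  rw [h.tsum_eq, ENNReal.ofReal_one] at h2
  rw [h2]
  refine tsum_congr fun i => ?_
  rw [ENNReal.ofReal_pow (norm_nonneg _), ofReal_norm]

end HilbertBasis

/-! ### Gaussian sums over the lattice -/

section Lattice

/-- Factorizes the Gaussian sum over `ℤ³` into one-dimensional sums. -/
lemma tsum_pi_prod {κ : Type*} (g : κ → ℝ≥0∞) (n : ℕ) :
    ∑' k : Fin n → κ, ∏ i, g (k i) = (∑' j, g j) ^ n := by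
  induction n with
  | zero => simp
  | succ n ih =>
    rw [← (Fin.consEquiv fun _ : Fin (n + 1) => κ).tsum_eq, ENNReal.tsum_prod', pow_succ']
    simp only [Fin.consEquiv_apply, Fin.prod_univ_succ, Fin.cons_zero, Fin.cons_succ,
      ENNReal.tsum_mul_left, ENNReal.tsum_mul_right, ih]

/-- Comparison with a geometric series through `|k| ≤ k²`. -/
lemma tsum_int_exp_sq_lt_top {c : ℝ} (hc : 0 < c) :
    ∑' k : ℤ, ENNReal.ofReal (Real.exp (-(c * (k : ℝ) ^ 2))) < ∞ := by
  have h1 : Summable fun n : ℕ => Real.exp (-c) ^ n :=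
    summable_geometric_of_lt_one (Real.exp_pos _).le (Real.exp_lt_one_iff.2 (by linarith))
  have h2 : Summable fun k : ℤ => Real.exp (-c) ^ k.natAbs := by
    refine Summable.of_nat_of_neg ?_ ?_ <;> simpa using h1
  refine lt_of_le_of_lt (ENNReal.tsum_le_tsum fun k => ?_) h2.tsum_ofReal_lt_top
  refine ENNReal.ofReal_le_ofReal ?_
  rw [← Real.exp_nat_mul]
  refine Real.exp_le_exp.2 ?_
  have h3 : ((k.natAbs : ℕ) : ℝ) ≤ (k : ℝ) ^ 2 := by
    have : (k.natAbs : ℤ) ≤ k ^ 2 := by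
      rw [← Int.natAbs_sq]
      exact_mod_cast Nat.le_self_pow two_ne_zero _
    rw [Int.natCast_natAbs] at this
    rw [Nat.cast_natAbs]
    exact_mod_cast this
  nlinarith

lemma tsum_exp_torusEigenvalue_lt_top {t : ℝ} (ht : 0 < t) :
    ∑' k, ENNReal.ofReal (Real.exp (-(torusEigenvalue k * t))) < ∞ := by
  have h : ∀ k : Fin 3 → ℤ, ENNReal.ofReal (Real.exp (-(torusEigenvalue k * t))) =
      ∏ i, ENNReal.ofReal (Real.exp (-(4 * Real.pi ^ 2 * t * (k i : ℝ) ^ 2))) := by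
    intro k
    rw [← ENNReal.ofReal_prod_of_nonneg fun i _ => (Real.exp_pos _).le, ← Real.exp_sum,
      torusEigenvalue, EuclideanSpace.norm_sq_eq]
    congr 2
    rw [Finset.sum_neg_distrib, ← Finset.mul_sum]
    simp only [latticePoint_apply, Real.norm_eq_abs, sq_abs]
    ring
  simp_rw [h, tsum_pi_prod fun j : ℤ => ENNReal.ofReal
    (Real.exp (-(4 * Real.pi ^ 2 * t * (j : ℝ) ^ 2)))]
  exact ENNReal.pow_lt_top (tsum_int_exp_sq_lt_top (by positivity))

end Lattice

/-! ### Eigenbases of the torus -/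

section Eigenbasis

/-- The orthonormal basis of the exponentials `e^{2πi k·x}`. -/
def torusBasis : HilbertBasis (Fin 3 → ℤ) ℂ (Lp ℂ 2 torusMeasure) := UnitAddTorus.mFourierBasis

lemma inner_torusBasis (g : Lp ℂ 2 torusMeasure) (k : Fin 3 → ℤ) :
    inner ℂ (torusBasis k) g = UnitAddTorus.mFourierCoeff g k := by
  rw [← torusBasis.repr_apply_apply]
  exact UnitAddTorus.mFourierBasis_repr g k

lemma mFourierCoeff_eq_integral_torusMeasure {E : Type*} [NormedAddCommGroup E] [NormedSpace ℂ E]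
    (u : T3 → E) (k : Fin 3 → ℤ) : UnitAddTorus.mFourierCoeff u k =
      ∫ x, UnitAddTorus.mFourier (-k) x • u x ∂torusMeasure := rfl

variable {ι : Type*} {e : HilbertBasis ι ℂ (Lp ℂ 2 torusMeasure)}

/-- The eigenvalue equation forces all nonzero Fourier modes of `e n` onto one sphere, and there is
at least one such mode because `e n ≠ 0`. The number `s n` is the square root of the eigenvalue. -/
lemma IsBoundedEigenbasis.exists_frequency (he : IsBoundedEigenbasis e) :
    ∃ s : ι → ℝ, (∀ n, 0 ≤ s n) ∧ ∀ n k, UnitAddTorus.mFourierCoeff (e n) k ≠ 0 →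
      s n = 2 * Real.pi * ‖latticePoint k‖ := by
  have h : ∀ n, ∃ s : ℝ, 0 ≤ s ∧ ∀ k, UnitAddTorus.mFourierCoeff (e n) k ≠ 0 →
      s = 2 * Real.pi * ‖latticePoint k‖ := by
    intro n
    obtain ⟨k₀, hk₀⟩ : ∃ k, UnitAddTorus.mFourierCoeff (e n) k ≠ 0 := by
      by_contra! h0
      have h1 : torusBasis.repr (e n) = 0 := by
        ext k
        rw [torusBasis.repr_apply_apply, inner_torusBasis, h0]
        rfl
      exact e.orthonormal.ne_zero n (by simpa using h1)
    obtain ⟨μ, hμ⟩ := he.eigen n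
    refine ⟨2 * Real.pi * ‖latticePoint k₀‖, by positivity, fun k hk => ?_⟩
    have h1 : torusEigenvalue k₀ = torusEigenvalue k := by
      have e₁ := mul_right_cancel₀ hk₀ (hμ k₀)
      have e₂ := mul_right_cancel₀ hk (hμ k)
      exact_mod_cast e₁.trans e₂.symm
    have h2 : (2 * Real.pi * ‖latticePoint k₀‖) ^ 2 = (2 * Real.pi * ‖latticePoint k‖) ^ 2 := by
      simp only [torusEigenvalue] at h1
      linarith
    exact (sq_eq_sq₀ (by positivity) (by positivity)).1 h2
  choose s hs using h
  exact ⟨s, fun n => (hs n).1, fun n => (hs n).2⟩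

/-- The heat trace is finite. -/
lemma tsum_exp_frequency_lt_top {s : ι → ℝ} (hs : ∀ n k, UnitAddTorus.mFourierCoeff (e n) k ≠ 0 →
      s n = 2 * Real.pi * ‖latticePoint k‖) {t : ℝ} (ht : 0 < t) :
    ∑' n, ENNReal.ofReal (Real.exp (-(s n ^ 2 * t))) < ∞ := by
  have h1 : ∀ n, ∑' k, ‖inner ℂ (torusBasis k) (e n)‖ₑ ^ 2 = 1 := by
    exact fun n => tsum_enorm_inner_sq torusBasis (e.orthonormal.1 n)
  have h2 : ∀ k, ∑' n, ‖inner ℂ (torusBasis k) (e n)‖ₑ ^ 2 = 1 := by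
    intro k
    have h := tsum_enorm_inner_sq e (torusBasis.orthonormal.1 k)
    simp_rw [← ofReal_norm, norm_inner_symm (torusBasis k)]
    simpa only [ofReal_norm] using h
  -- The trace does not depend on the basis: the matrix `|⟨e_k, e_n⟩|²` has row and column sums `1`,
  -- and the two eigenvalues agree wherever its entry is nonzero.
  calc _ = ∑' n, ∑' k, ENNReal.ofReal (Real.exp (-(s n ^ 2 * t))) *
        ‖inner ℂ (torusBasis k) (e n)‖ₑ ^ 2 := by
        simp_rw [ENNReal.tsum_mul_left, h1, mul_one]
    _ = ∑' n, ∑' k, ENNReal.ofReal (Real.exp (-(torusEigenvalue k * t))) *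
        ‖inner ℂ (torusBasis k) (e n)‖ₑ ^ 2 := by
        refine tsum_congr fun n => tsum_congr fun k => ?_
        by_cases h0 : UnitAddTorus.mFourierCoeff (e n) k = 0
        · simp [inner_torusBasis, h0]
        · rw [hs n k h0, torusEigenvalue]
          congr 4
          ring
    _ = ∑' k, ENNReal.ofReal (Real.exp (-(torusEigenvalue k * t))) := by
        rw [ENNReal.tsum_comm]
        simp_rw [ENNReal.tsum_mul_left, h2, mul_one]
    _ < ∞ := tsum_exp_torusEigenvalue_lt_top ht

end Eigenbasis

/-! ### Sobolev norms on the torus -/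

section TorusNorm

variable {d : ℕ}

lemma summable_norm_sq_iff {ι : Type*} {a : ι → Val d} :
    (Summable fun n => ‖a n‖ ^ 2) ↔ ∑' n, ‖a n‖ₑ ^ 2 ≠ ∞ := by
  have h := tsum_enorm_ne_top_iff_summable_norm (f := fun n => ‖a n‖ ^ 2)
  simp only [enorm_pow, enorm_norm, norm_pow, norm_norm] at h
  exact h.symm

lemma torusHdotNorm_lt_top_iff {s : ℝ} {f : TorusDist d} :
    torusHdotNorm s f < ∞ ↔ Summable fun k => ‖torusD s f k‖ ^ 2 := by
  rw [torusHdotNorm, eLpNorm_lt_top_iff_lintegral_rpow_enorm_lt_top two_ne_zero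
    ENNReal.ofNat_ne_top, lintegral_count, summable_norm_sq_iff, lt_top_iff_ne_top]
  simp

lemma latticePoint_norm_pos {k : Fin 3 → ℤ} (hk : k ≠ 0) : 0 < ‖latticePoint k‖ := by
  refine norm_pos_iff.2 fun h => hk (funext fun i => ?_)
  have : latticePoint k i = 0 := by rw [h]; rfl
  simpa using this

lemma torusD_neg_torusD (s : ℝ) {f : TorusDist d} (hf : f 0 = 0) :
    torusD (-s) (torusD s f) = f := by
  ext1 k
  by_cases hk : k = 0
  · simp [torusD, hk, hf]
  · have h := latticePoint_norm_pos hk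
    simp only [torusD, hk, if_false]
    rw [smul_smul, ← Real.rpow_add (by positivity), neg_add_cancel, Real.rpow_zero, one_smul]

lemma torusHdotNorm_ne_zero {s : ℝ} {f : TorusDist d} (hf₀ : f 0 = 0) (hf : f ≠ 0) :
    torusHdotNorm s f ≠ 0 := by
  intro h
  rw [torusHdotNorm, eLpNorm_eq_zero_iff (measurable_of_countable _).aestronglyMeasurable
    two_ne_zero, Filter.EventuallyEq, Measure.ae_count_iff] at h
  apply hf
  have h0 : torusD s f = 0 := funext h
  rw [← torusD_neg_torusD s hf₀, h0]
  ext1 k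
  simp [torusD]

end TorusNorm

/-! ### The heat flow on the torus in a bounded eigenbasis -/

section TorusFlow

variable {ι : Type*} {e : HilbertBasis ι ℂ (Lp ℂ 2 torusMeasure)} {s : ι → ℝ} {d : ℕ} {α t : ℝ}

/-- The heat flow of `D^α` of the component `e_n b_n`, where `s_n²` is the eigenvalue of `e_n`. -/
def torusPiece (α : ℝ) (e : HilbertBasis ι ℂ (Lp ℂ 2 torusMeasure)) (s : ι → ℝ) (b : ι → Val d)
    (n : ι) (z : ℝ × T3) : Val d :=
  ((heatWeight α (s n) z.1 : ℝ) : ℂ) • e n z.2 • b n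

/-- The heat flow of `D^α ∑ e_n b_n`. -/
def torusFlow (α : ℝ) (e : HilbertBasis ι ℂ (Lp ℂ 2 torusMeasure)) (s : ι → ℝ) (b : ι → Val d)
    (t : ℝ) (x : T3) : Val d := ∑' n, torusPiece α e s b n (t, x)

lemma stronglyMeasurable_torusPiece (b : ι → Val d) (n : ι) :
    StronglyMeasurable (torusPiece α e s b n) := by
  have h1 : Measurable fun z : ℝ × T3 => ((heatWeight α (s n) z.1 : ℝ) : ℂ) := by
    unfold heatWeight; fun_prop
  exact h1.stronglyMeasurable.smul
    (((Lp.stronglyMeasurable (e n)).comp_measurable measurable_snd).smul_const (b n))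

lemma norm_torusPiece_le (hs₀ : ∀ n, 0 ≤ s n) (b : ι → Val d) (n : ι) {C : ℝ} {x : T3}
    (hx : ‖e n x‖ ≤ C) : ‖torusPiece α e s b n (t, x)‖ ≤ C * (heatWeight α (s n) t * ‖b n‖) := by
  have h := heatWeight_nonneg (α := α) (t := t) (hs₀ n)
  rw [torusPiece, norm_smul, norm_smul, Complex.norm_real, Real.norm_of_nonneg h]
  calc _ = ‖e n x‖ * (heatWeight α (s n) t * ‖b n‖) := by ring
    _ ≤ _ := by gcongr

/-- By `2xy ≤ x² + y²` it suffices to sum the squares of the weights, which the heat trace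
dominates. This gives absolute convergence of the flow at every positive time. -/
lemma summable_heatWeight_mul_norm (hs₀ : ∀ n, 0 ≤ s n)
    (hs : ∀ n k, UnitAddTorus.mFourierCoeff (e n) k ≠ 0 → s n = 2 * Real.pi * ‖latticePoint k‖)
    (hα₀ : 0 ≤ α) (hα : α ≤ 2) {b : ι → Val d} (hb : Summable fun n => ‖b n‖ ^ 2) (ht : 0 < t) :
    Summable fun n => heatWeight α (s n) t * ‖b n‖ := by
  have h1 := ENNReal.summable_toReal (tsum_exp_frequency_lt_top hs ht).ne
  simp only [ENNReal.toReal_ofReal (Real.exp_pos _).le] at h1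
  refine Summable.of_nonneg_of_le
    (fun n => mul_nonneg (heatWeight_nonneg (hs₀ n)) (norm_nonneg _)) (fun n => ?_)
    ((h1.mul_left ((1 + 1 / (t / 2)) ^ 2)).add hb)
  have h2 := heatWeight_sq_le hα₀ hα ht (hs₀ n)
  have h3 := two_mul_le_add_sq (heatWeight α (s n) t) ‖b n‖
  have h4 := mul_nonneg (heatWeight_nonneg (α := α) (t := t) (hs₀ n)) (norm_nonneg (b n))
  linarith

lemma lintegral_torusEnergy_rpow_lt_top [Countable ι] (hs₀ : ∀ n, 0 ≤ s n) (hα₀ : 0 ≤ α) {p : ℝ}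
    (hp : 2 ≤ p) (hαp : α * p ≤ 2) {a : ι → Val d} (ha : ∑' n, ‖a n‖ₑ ^ 2 ≠ ∞) :
    ∫⁻ t in Set.Icc (0 : ℝ) 1,
      (∑' n, ENNReal.ofReal (heatWeight α (s n) t) ^ 2 * ‖a n‖ₑ ^ 2) ^ (p / 2) < ∞ := by
  -- The index set becomes a discrete measure space, with mass `‖a n‖²` at `n` in the role of the
  -- frequency energy.
  let _ : MeasurableSpace ι := ⊤
  set ν := (Measure.count : Measure ι).withDensity fun n => ‖a n‖ₑ ^ 2 with hν
  have : IsFiniteMeasure ν := isFiniteMeasure_withDensity (by rwa [lintegral_count])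
  refine lt_of_le_of_lt (le_of_eq ?_)
    (lintegral_heatEnergy_rpow_lt_top ν (measurable_of_countable s) hs₀ hα₀ hp hαp)
  refine lintegral_congr fun t => ?_
  rw [hν, lintegral_withDensity_eq_lintegral_mul _ (measurable_of_countable _)
    (measurable_of_countable _), lintegral_count]
  simp only [Pi.mul_apply, ENNReal.rpow_two, mul_comm]

lemma hasSum_torusFlow (hs₀ : ∀ n, 0 ≤ s n)
    (hs : ∀ n k, UnitAddTorus.mFourierCoeff (e n) k ≠ 0 → s n = 2 * Real.pi * ‖latticePoint k‖)
    (hα₀ : 0 ≤ α) (hα : α ≤ 2) {b : ι → Val d} (hb : Summable fun n => ‖b n‖ ^ 2) (ht : 0 < t)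
    {C : ℝ} {x : T3} (hx : ∀ n, ‖e n x‖ ≤ C) :
    HasSum (fun n => torusPiece α e s b n (t, x)) (torusFlow α e s b t x) :=
  (Summable.of_norm_bounded ((summable_heatWeight_mul_norm hs₀ hs hα₀ hα hb ht).mul_left C)
    fun n => norm_torusPiece_le hs₀ b n (hx n)).hasSum

variable [Countable ι]

lemma aestronglyMeasurable_torusFlow (hs₀ : ∀ n, 0 ≤ s n)
    (hs : ∀ n k, UnitAddTorus.mFourierCoeff (e n) k ≠ 0 → s n = 2 * Real.pi * ‖latticePoint k‖)
    (hα₀ : 0 ≤ α) (hα : α ≤ 2) {b : ι → Val d} (hb : Summable fun n => ‖b n‖ ^ 2)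
    {C : ℝ} (hC : ∀ᵐ x ∂torusMeasure, ∀ n, ‖e n x‖ ≤ C) :
    AEStronglyMeasurable (fun z : ℝ × T3 => torusFlow α e s b z.1 z.2)
      ((volume.restrict (Set.Icc (0 : ℝ) 1)).prod torusMeasure) := by
  refine aestronglyMeasurable_of_tendsto_ae (Filter.atTop : Filter (Finset ι))
    (f := fun I z => ∑ n ∈ I, torusPiece α e s b n z) (fun I =>
      (Finset.stronglyMeasurable_fun_sum I fun n _ =>
        stronglyMeasurable_torusPiece b n).aestronglyMeasurable) ?_
  filter_upwards [Measure.quasiMeasurePreserving_fst.ae (ae_pos_restrict_Icc 1),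
    Measure.quasiMeasurePreserving_snd.ae hC] with z hz1 hz2
  exact hasSum_torusFlow hs₀ hs hα₀ hα hb hz1 hz2

lemma aestronglyMeasurable_torusFlow_apply (hs₀ : ∀ n, 0 ≤ s n)
    (hs : ∀ n k, UnitAddTorus.mFourierCoeff (e n) k ≠ 0 → s n = 2 * Real.pi * ‖latticePoint k‖)
    (hα₀ : 0 ≤ α) (hα : α ≤ 2) {b : ι → Val d} (hb : Summable fun n => ‖b n‖ ^ 2) (ht : 0 < t)
    {C : ℝ} (hC : ∀ᵐ x ∂torusMeasure, ∀ n, ‖e n x‖ ≤ C) :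
    AEStronglyMeasurable (torusFlow α e s b t) torusMeasure := by
  refine aestronglyMeasurable_of_tendsto_ae (Filter.atTop : Filter (Finset ι))
    (f := fun I x => ∑ n ∈ I, torusPiece α e s b n (t, x)) (fun I =>
      (Finset.stronglyMeasurable_fun_sum I fun n _ =>
        (stronglyMeasurable_torusPiece b n).comp_measurable
          measurable_prodMk_left).aestronglyMeasurable) ?_
  filter_upwards [hC] with x hx using hasSum_torusFlow hs₀ hs hα₀ hα hb ht hx

/-- The Fourier coefficients of the heat flow. -/
lemma torusRepresents_torusFlow (hs₀ : ∀ n, 0 ≤ s n)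
    (hs : ∀ n k, UnitAddTorus.mFourierCoeff (e n) k ≠ 0 → s n = 2 * Real.pi * ‖latticePoint k‖)
    (hα₀ : 0 < α) (hα : α ≤ 2) {b : ι → Val d} (hb : Summable fun n => ‖b n‖ ^ 2) (ht : 0 < t)
    {C : ℝ} (hC : ∀ᵐ x ∂torusMeasure, ∀ n, ‖e n x‖ ≤ C) {β : TorusDist d}
    (hβ : ∀ k, HasSum (fun n => UnitAddTorus.mFourierCoeff (e n) k • b n) (β k)) :
    TorusRepresents (torusFlow α e s b t) (torusHeat t (torusD α β)) := by
  have hsum := (summable_heatWeight_mul_norm hs₀ hs hα₀.le hα hb ht).mul_left C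
  have hm := aestronglyMeasurable_torusFlow_apply hs₀ hs hα₀.le hα hb ht hC
  refine ⟨Integrable.of_bound hm (∑' n, C * (heatWeight α (s n) t * ‖b n‖)) ?_, fun k => ?_⟩
  · filter_upwards [hC] with x hx
    exact tsum_of_norm_bounded hsum.hasSum fun n => norm_torusPiece_le hs₀ b n (hx n)
  · have hcont : Continuous fun x : T3 => UnitAddTorus.mFourier (-k) x :=
      (UnitAddTorus.mFourier (-k)).continuous
    have hnorm : ∀ x : T3, ‖UnitAddTorus.mFourier (-k) x‖ ≤ 1 := fun x =>
      (ContinuousMap.norm_coe_le_norm _ x).trans UnitAddTorus.mFourier_norm.le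
    have h1 : HasSum (fun n => ∫ x, UnitAddTorus.mFourier (-k) x • torusPiece α e s b n (t, x)
        ∂torusMeasure) (∫ x, UnitAddTorus.mFourier (-k) x • torusFlow α e s b t x ∂torusMeasure) := by
      refine hasSum_integral_of_dominated_convergence
        (fun n _ => C * (heatWeight α (s n) t * ‖b n‖)) (fun n => ?_) (fun n => ?_)
        (ae_of_all _ fun _ => hsum) (integrable_const _) ?_
      · exact hcont.aestronglyMeasurable.smul ((stronglyMeasurable_torusPiece b n).comp_measurable
          measurable_prodMk_left).aestronglyMeasurable
      · filter_upwards [hC] with x hx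
        rw [norm_smul]
        exact (mul_le_of_le_one_left (norm_nonneg _) (hnorm x)).trans
          (norm_torusPiece_le hs₀ b n (hx n))
      · filter_upwards [hC] with x hx
        exact (hasSum_torusFlow hs₀ hs hα₀.le hα hb ht hx).const_smul _
    have h2 := (hβ k).const_smul (heatWeight α (2 * Real.pi * ‖latticePoint k‖) t)
    have h3 : ∀ n, ∫ x, UnitAddTorus.mFourier (-k) x • torusPiece α e s b n (t, x) ∂torusMeasure =
        heatWeight α (2 * Real.pi * ‖latticePoint k‖) t •
          UnitAddTorus.mFourierCoeff (e n) k • b n := by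
      intro n
      simp only [torusPiece, ← smul_assoc, integral_smul_const]
      congr 1
      have h4 : ∀ x : T3, UnitAddTorus.mFourier (-k) x • ((heatWeight α (s n) t : ℝ) : ℂ) • e n x =
          ((heatWeight α (s n) t : ℝ) : ℂ) * UnitAddTorus.mFourier (-k) x • e n x := by
        intro x; simp only [smul_eq_mul]; ring
      simp only [smul_assoc, h4, integral_const_mul, ← mFourierCoeff_eq_integral_torusMeasure]
      -- Where the coefficient is nonzero, `s n` is the frequency of the mode `k`, so the weight
      -- depends on `k` alone.
      by_cases h0 : UnitAddTorus.mFourierCoeff (e n) k = 0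
      · simp [h0]
      · rw [hs n k h0, Complex.real_smul]
    rw [mFourierCoeff_eq_integral_torusMeasure]
    simp only [h3] at h1
    rw [h1.unique h2, torusHeat, torusD, torusEigenvalue, heatWeight]
    -- At `k = 0` both sides vanish: `torusD` drops this mode, and the weight is `0^α = 0` because
    -- `α > 0`.
    by_cases hk : k = 0
    · have : latticePoint 0 = 0 := by ext i; simp
      simp [hk, this, Real.zero_rpow hα₀.ne']
    · rw [if_neg hk, smul_smul, mul_comm]
      congr 4
      ring

/-- On a probability space the `L^q` norm is at most the `L^Q` norm. -/
lemma lintegral_mixed_mono {X : Type*} [MeasurableSpace X] (μ : Measure X) [IsProbabilityMeasure μ]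
    {w : ℝ → X → Val d} (hw : ∀ t, 0 < t → AEStronglyMeasurable (w t) μ) {p q Q : ℝ} (hp : 0 < p)
    (hq : 0 < q) (hqQ : q ≤ Q) :
    ∫⁻ t in Set.Icc (0 : ℝ) 1, (∫⁻ x, ‖w t x‖ₑ ^ q ∂μ) ^ (p / q) ≤
      ∫⁻ t in Set.Icc (0 : ℝ) 1, (∫⁻ x, ‖w t x‖ₑ ^ Q ∂μ) ^ (p / Q) := by
  have hQ : 0 < Q := hq.trans_le hqQ
  refine lintegral_mono_ae ?_
  filter_upwards [ae_pos_restrict_Icc 1] with t ht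
  have h1 := lintegral_rpow_le μ ((hw t ht).enorm.pow_const Q) (div_pos hq hQ)
    ((div_le_one hQ).2 hqQ)
  simp only [← ENNReal.rpow_mul, mul_div_cancel₀ q hQ.ne'] at h1
  refine (ENNReal.rpow_le_rpow h1 (by positivity)).trans (le_of_eq ?_)
  rw [← ENNReal.rpow_mul]
  congr 1
  field_simp

end TorusFlow

/-! ### Almost sure bounds and good sets on the torus -/

section TorusMain

variable {Ω : Type*} [MeasurableSpace Ω] {P : Measure Ω} [IsProbabilityMeasure P]
  {ι : Type*} [Countable ι] {e : HilbertBasis ι ℂ (Lp ℂ 2 torusMeasure)} {s : ι → ℝ}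
  {d : ℕ} {α : ℝ} {h : ι → Ω → ℝ} {v : ℝ≥0}

theorem ae_lintegral_torusFlow_lt_top (hlaw : ∀ n, HasLaw (h n) (gaussianReal 0 v) P)
    (hind : iIndepFun h P) (hs₀ : ∀ n, 0 ≤ s n)
    (hs : ∀ n k, UnitAddTorus.mFourierCoeff (e n) k ≠ 0 → s n = 2 * Real.pi * ‖latticePoint k‖)
    (hα₀ : 0 ≤ α) (hα : α ≤ 2) {C : ℝ} (hC : ∀ᵐ x ∂torusMeasure, ∀ n, ‖e n x‖ ≤ C)
    {p q : ℝ} (hp : 2 ≤ p) (hq : 2 ≤ q) (hαp : α * p ≤ 2) {a : ι → Val d}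
    (ha : Summable fun n => ‖a n‖ ^ 2) :
    ∀ᵐ ω ∂P, (Summable fun n => ‖(h n ω : ℂ) • a n‖ ^ 2) →
      ∫⁻ t in Set.Icc (0 : ℝ) 1, (∫⁻ x, ‖torusFlow α e s (fun n => (h n ω : ℂ) • a n) t x‖ₑ ^ q
        ∂torusMeasure) ^ (p / q) < ∞ := by
  set E : ℝ → ℝ≥0∞ := fun t =>
    ∑' n, ENNReal.ofReal (heatWeight α (s n) t) ^ 2 * ‖a n‖ₑ ^ 2 with hE
  have hp2 : 0 ≤ p / 2 := by linarith
  have hsup : ∀ t, 0 < t → ∀ᵐ x ∂torusMeasure, ∑' n, ‖torusPiece α e s a n (t, x)‖ₑ ^ 2 ≤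
      ENNReal.ofReal C ^ 2 * E t := by
    intro t ht
    filter_upwards [hC] with x hx
    rw [hE, ← ENNReal.tsum_mul_left]
    refine ENNReal.tsum_le_tsum fun n => ?_
    rw [← mul_pow, ← mul_pow, ← ofReal_norm (torusPiece α e s a n (t, x)), ← ofReal_norm (a n),
      ← ENNReal.ofReal_mul (heatWeight_nonneg (hs₀ n)),
      ← ENNReal.ofReal_mul ((norm_nonneg _).trans (hx n))]
    gcongr
    exact norm_torusPiece_le hs₀ a n (hx n)
  have hEt : ∀ t, 0 < t → ENNReal.ofReal C ^ 2 * E t ≠ ∞ := by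
    intro t ht
    have h1 : E t ≤ ENNReal.ofReal (1 + 1 / t) ^ 2 * ∑' n, ‖a n‖ₑ ^ 2 := by
      rw [← ENNReal.tsum_mul_left]
      refine ENNReal.tsum_le_tsum fun n => ?_
      gcongr
      exact heatWeight_le hα₀ hα ht (hs₀ n)
    have h2 := summable_norm_sq_iff.1 ha
    exact ENNReal.mul_ne_top (by finiteness) (ne_top_of_le_ne_top (by finiteness) h1)
  have h1 := ae_lintegral_gaussian_series_lt_top hlaw hind torusMeasure hp (le_max_left p q)
    (u := torusPiece α e s a) (stronglyMeasurable_torusPiece a)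
    (B := fun t => ENNReal.ofReal C ^ 2 * E t) hsup
    -- The torus has total mass `1`, so the uniform bound implies the `L¹` bound.
    (fun t ht => (lintegral_mono_ae (hsup t ht)).trans (by simp))
    (by
      simp_rw [ENNReal.mul_rpow_of_nonneg _ _ hp2]
      have hc : (ENNReal.ofReal C ^ 2) ^ (p / 2) ≠ ∞ :=
        ENNReal.rpow_ne_top_of_nonneg hp2 (by finiteness)
      rw [lintegral_const_mul' _ _ hc]
      exact ENNReal.mul_lt_top hc.lt_top
        (lintegral_torusEnergy_rpow_lt_top hs₀ hα₀ hp hαp (summable_norm_sq_iff.1 ha)))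
    hEt
  filter_upwards [h1] with ω hω hb
  refine (lintegral_mixed_mono torusMeasure (fun t ht =>
    aestronglyMeasurable_torusFlow_apply hs₀ hs hα₀ hα hb ht hC) (by linarith) (by linarith)
    (le_max_right p q)).trans_lt (hω _ fun t ht => ?_)
  filter_upwards [hC] with x hx
  convert hasSum_torusFlow hs₀ hs hα₀ hα hb ht hx using 2 with n
  simp only [torusPiece]
  rw [smul_comm _ (h n ω : ℂ), smul_comm _ (h n ω : ℂ)]

theorem exists_torusGoodSet (he : IsBoundedEigenbasis e)
    (hlaw : ∀ n, HasLaw (h n) (gaussianReal 0 v) P) (hind : iIndepFun h P) (hα₀ : 0 < α)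
    (hα : α ≤ 2) {p₁ p₂ q₁ q₂ : ℝ} (hp₁ : 2 ≤ p₁) (hp₂ : 2 ≤ p₂) (hq₁ : 2 ≤ q₁) (hq₂ : 2 ≤ q₂)
    (hαp₁ : α * p₁ ≤ 2) (hαp₂ : α * p₂ ≤ 2) {f : TorusDist d} (hf0 : f 0 = 0)
    (hf : torusHdotNorm (-α) f < ∞) (hf₀ : f ≠ 0) :
    ∀ᵐ ω ∂P, ∀ lam : ℝ, 0 < lam → ∃ δ : ℝ, 0 < δ ∧ ∃ M : ℝ, 0 < M ∧
      ω ∈ torusGoodSet α e h f p₁ q₁ M δ ∩ torusGoodSet α e h f p₂ q₂ lam δ := by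
  obtain ⟨s, hs₀, hs⟩ := he.exists_frequency
  obtain ⟨C, hC⟩ := he.bounded
  rw [← ae_all_iff] at hC
  obtain ⟨a, ha, haf, hfa⟩ := exists_change_hilbertBasis torusBasis e
    (torusHdotNorm_lt_top_iff.1 hf)
  -- Eigenfunctions of frequency `0` see only the mode `k = 0`, which is absent from `D^{-α} f`.
  -- This keeps the randomized series mean zero.
  have ha0 : ∀ n, s n = 0 → a n = 0 := by
    intro n hn
    refine (haf n).unique ?_
    convert hasSum_zero using 2 with k
    by_cases hk : k = 0
    · simp [hk, torusD]
    · have h1 : inner ℂ (torusBasis k) (e n) = 0 := by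
        rw [inner_torusBasis]
        by_contra h2
        have h3 := hs n k h2
        have h4 := latticePoint_norm_pos hk
        rw [hn] at h3
        have : 0 < 2 * Real.pi * ‖latticePoint k‖ := by positivity
        linarith
      rw [← inner_conj_symm, h1]
      simp
  simp only [inner_torusBasis] at hfa
  filter_upwards [ae_tsum_gaussian_sq_lt_top hlaw (summable_norm_sq_iff.1 ha),
    ae_lintegral_torusFlow_lt_top hlaw hind hs₀ hs hα₀.le hα hC hp₁ hq₁ hαp₁ ha,
    ae_lintegral_torusFlow_lt_top hlaw hind hs₀ hs hα₀.le hα hC hp₂ hq₂ hαp₂ ha]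
    with ω hc h1 h2 lam hlam
  have hb : Summable fun n => ‖(h n ω : ℂ) • a n‖ ^ 2 := by
    rw [summable_norm_sq_iff]
    convert hc.ne using 4 with n
    rw [enorm_smul, mul_pow, ← ofReal_norm (h n ω : ℂ), Complex.norm_real, ofReal_norm]
  -- `β` collects the Fourier coefficients of `D^{-α} f^ω`; the randomization is then `torusD α β`,
  -- and `β 0 = 0` makes `torusD (-α)` undo `torusD α`.
  obtain ⟨β, hβ, hbβ, -⟩ := exists_change_hilbertBasis e torusBasis hb
  simp only [inner_torusBasis] at hbβ
  have hβ0 : β 0 = 0 := by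
    refine (hbβ 0).unique ?_
    convert hasSum_zero using 2 with n
    by_cases h3 : UnitAddTorus.mFourierCoeff (e n) 0 = 0
    · simp [h3]
    · have h4 : latticePoint 0 = 0 := by ext i; simp
      rw [ha0 n (by rw [hs n 0 h3, h4, norm_zero, mul_zero]), smul_zero, smul_zero]
  have hD := torusD_neg_torusD α hβ0
  have hrand : IsTorusRandomization α e (fun n => h n ω) f (torusD α β) := by
    refine ⟨by simp [torusD], torusHdotNorm_lt_top_iff.2 (by rwa [hD]), a, ha, hfa, fun k => ?_⟩
    rw [hD]
    convert hbβ k using 2 with n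
    rw [smul_comm]
  obtain ⟨δ, hδ, M, hM, hn1, hn2⟩ := exists_timeSpaceNorm_lt
    (rep := fun t u => TorusRepresents u (torusHeat t (torusD α β)))
    (w := torusFlow α e s fun n => (h n ω : ℂ) • a n)
    (p₁ := p₁) (p₂ := p₂) (q₁ := q₁) (q₂ := q₂) (by linarith) (by linarith) (by linarith)
    (by linarith) (aestronglyMeasurable_torusFlow hs₀ hs hα₀.le hα hb hC)
    (fun t ht => torusRepresents_torusFlow hs₀ hs hα₀ hα hb ht hC hbβ) (h1 hb) (h2 hb)
    (torusHdotNorm_ne_zero (s := -α) hf0 hf₀) hlam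
  exact ⟨δ, hδ, M, hM, ⟨_, hrand, hn1⟩, ⟨_, hrand, hn2⟩⟩

end TorusMain

lemma exists_measurableSet_of_ae {Ω : Type*} [MeasurableSpace Ω] {P : Measure Ω}
    [IsProbabilityMeasure P] {Q : Ω → Prop} (hQ : ∀ᵐ ω ∂P, Q ω) :
    ∃ S : Set Ω, MeasurableSet S ∧ P S = 1 ∧ ∀ ω ∈ S, Q ω := by
  obtain ⟨t, ht, htm, hPt⟩ := exists_measurable_superset_of_null (ae_iff.1 hQ)
  exact ⟨tᶜ, htm.compl, (prob_compl_eq_one_iff htm).2 hPt,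
    fun ω hω => by_contra fun h => hω (ht h)⟩

end

end RandomHeat

theorem proposition2p7 {Ω : Type*} [MeasurableSpace Ω] (P : Measure Ω) [IsProbabilityMeasure P]
    (d : ℕ) (α p₁ p₂ q₁ q₂ r : ℝ) (hα₀ : 0 < α) (hα₁ : α < 1)
    (hp₁ : 2 ≤ p₁) (hp₁r : p₁ ≤ r) (hp₂ : 2 ≤ p₂) (hp₂r : p₂ ≤ r)
    (hq₁ : 2 ≤ q₁) (hq₁r : q₁ ≤ r) (hq₂ : 2 ≤ q₂) (hq₂r : q₂ ≤ r)
    (hαp₁ : α * p₁ ≤ 2) (hαp₂ : α * p₂ < 2) (v : ℝ≥0) :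
    (∀ (ϕ : RandomHeat.R3 → ℝ) (_ : RandomHeat.IsCutoff ϕ)
      (h : (Fin 3 → ℤ) → Ω → ℝ) (_ : ∀ n, HasLaw (h n) (gaussianReal 0 v) P) (_ : iIndepFun h P)
      (f : 𝓢'(RandomHeat.R3, RandomHeat.Val d)) (_ : RandomHeat.hdotNorm (-α) f < ∞) (_ : f ≠ 0),
      ∃ S : Set Ω, MeasurableSet S ∧ P S = 1 ∧
        ∀ lam : ℝ, 0 < lam → ∀ ω ∈ S, ∃ δ : ℝ, 0 < δ ∧ ∃ M : ℝ, 0 < M ∧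
          ω ∈ RandomHeat.goodSet α ϕ h f p₁ q₁ M δ ∩ RandomHeat.goodSet α ϕ h f p₂ q₂ lam δ) ∧
    (∀ (ι : Type) (_ : Countable ι)
      (e : HilbertBasis ι ℂ (Lp ℂ 2 RandomHeat.torusMeasure))
      (_ : RandomHeat.IsBoundedEigenbasis e)
      (h : ι → Ω → ℝ) (_ : ∀ n, HasLaw (h n) (gaussianReal 0 v) P) (_ : iIndepFun h P)
      (f : RandomHeat.TorusDist d) (_ : f 0 = 0) (_ : RandomHeat.torusHdotNorm (-α) f < ∞)
      (_ : f ≠ 0),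
      ∃ S : Set Ω, MeasurableSet S ∧ P S = 1 ∧
        ∀ lam : ℝ, 0 < lam → ∀ ω ∈ S, ∃ δ : ℝ, 0 < δ ∧ ∃ M : ℝ, 0 < M ∧
          ω ∈ RandomHeat.torusGoodSet α e h f p₁ q₁ M δ ∩
            RandomHeat.torusGoodSet α e h f p₂ q₂ lam δ) := by
  constructor
  · intro ϕ hϕ h hlaw hind f hf hf₀
    obtain ⟨S, hS, hPS, hgood⟩ := RandomHeat.exists_measurableSet_of_ae
      (RandomHeat.exists_goodSet_wholeSpace hϕ hlaw hind hα₀.le (by linarith) hp₁ hp₂ hq₁ hq₂ hαp₁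
        hαp₂.le hf hf₀)
    exact ⟨S, hS, hPS, fun lam hlam ω hω => hgood ω hω lam hlam⟩
  · intro ι _ e he h hlaw hind f hf0 hf hf₀
    obtain ⟨S, hS, hPS, hgood⟩ := RandomHeat.exists_measurableSet_of_ae
      (RandomHeat.exists_torusGoodSet he hlaw hind hα₀ (by linarith) hp₁ hp₂ hq₁ hq₂ hαp₁
        hαp₂.le hf0 hf hf₀)
    exact ⟨S, hS, hPS, fun lam hlam ω hω => hgood ω hω lam hlam⟩
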